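/- **Setting.** Consider finite rooted binary trees with two types of carets, vertical and horizontal. Such a tree describes a partition of the unit square $(0,1]^2$ into dyadic rectangles $(\frac{i}{2^r},\frac{i+1}{2^r}]\times(\frac{j}{2^s},\frac{j+1}{2^s}]$, one for each leaf: a vertical caret cuts a rectangle into its left and right halves (the left and right child), a horizontal caret into its bottom and top halves (the left and right child). A tree-pair diagram $(T_+,\pi,T_-)$ consists of two such trees with the same number of leaves and a bijection $\pi$ between their leaves; it represents the bijection of the square that sends the rectangle of each leaf $i$ of $T_+$ onto the rectangle of the leaf $\pi(i)$ of $T_-$ by the affine map that is increasing in each coordinate. The maps so represented form a group under composition, the group $2V$. For $x\in 2V$ let $N(x)$ be the least number of carets (of either tree) in a tree-pair diagram that represents $x$. Let $R_k$ be the all-right tree with $k$ carets, all vertical, and number the leaves of a tree from left to right, starting from $0$. For $n\ge 0$ let * $A_n=(R_{n+1}$ with a vertical caret hung from leaf $n$, $\mathrm{id}$, $R_{n+2})$; * $B_n=(R_{n+1}$ with a horizontal caret hung from leaf $n$, $\mathrm{id}$, $R_{n+2})$; * $C_n=(R_{n+1}$ with its last caret made horizontal, $\mathrm{id}$, $R_{n+1})$;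 * $\pi_n=(R_{n+2},(n\ \,n{+}1),R_{n+2})$ and $\overline\pi_n=(R_{n+1},(n\ \,n{+}1),R_{n+1})$. **Theorem.** The standard finite set $\{A_0,A_1,B_0,B_1,C_0,C_1,\pi_0,\pi_1,\overline\pi_0,\overline\pi_1\}$ generates $2V$. Let $S$ be this set, or any other finite generating set of $2V$, and let $|x|$ be the word length of $x\in 2V$ with respect to $S$. Then: 1. There is $C>0$ such that $\log N(x)\le C\,|x|$ for all $x\in 2V$ (with $\log 0$ read as $0$; $N(x)=0$ only for the identity). 2. There is $C>0$ such that $|x|\le C\,N(x)\log N(x)$ for all $x\in 2V$ with $N(x)\ge 2$, and $|x|\le C$ for the finitely many $x$ with $N(x)\le 1$. 3. The lower bound is sharp: $N(C_0^n)=2^n-1$ for all $n\ge 0$, and there is $C>0$ such that $|C_0^n|\le C\log N(C_0^n)$ for all $n\ge 2$. 4. The upper bound is sharp, and is generically attained: there are $c>0$, $K>0$ and $0<r<1$ such that, for every $n\ge 0$, the fraction of the elements $x$ with $N(x)=n$ for which $|x|>c\,n\log n$ is at least $1-Kr^n$ (where $0\log 0$ is read as $0$). -/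

import Mathlib

namespace BrinThompson

/-! ## The unit square and its halvings -/

/-- The half-open unit interval `(0,1]` (half-open on the left, so that dyadic interpolations are
left-continuous, and the dyadic subintervals `(i/2^r, (i+1)/2^r]` partition it). -/
abbrev UnitIoc : Type := Set.Ioc (0 : ℝ) 1

/-- The unit square. -/
abbrev Square : Type := UnitIoc × UnitIoc

/-- The affine increasing bijection `t ↦ t / 2` from `(0,1]` onto its lower half `(0,1/2]`. -/
noncomputable def lowHalf (t : UnitIoc) : UnitIoc :=
  ⟨(t : ℝ) / 2, by have := t.2.1; have := t.2.2; constructor <;> linarith⟩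

/-- The affine increasing bijection `t ↦ (t + 1) / 2` from `(0,1]` onto its upper half `(1/2,1]`. -/
noncomputable def highHalf (t : UnitIoc) : UnitIoc :=
  ⟨((t : ℝ) + 1) / 2, by have := t.2.1; have := t.2.2; constructor <;> linarith⟩

/-- The affine identification of the square with its left half. -/
noncomputable def leftMap (p : Square) : Square := (lowHalf p.1, p.2)

/-- The affine identification of the square with its right half. -/
noncomputable def rightMap (p : Square) : Square := (highHalf p.1, p.2)

/-- The affine identification of the square with its bottom half. -/
noncomputable def bottomMap (p : Square) : Square := (p.1, lowHalf p.2)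

/-- The affine identification of the square with its top half. -/
noncomputable def topMap (p : Square) : Square := (p.1, highHalf p.2)

/-! ## Binary trees with two types of carets -/

/-- Finite rooted binary trees with vertical (triangular) and horizontal (square) carets. The
children of a vertical caret are the left and right halves of a rectangle; the children of a
horizontal caret are its bottom and top halves. -/
inductive CaretTree : Type
  | leaf : CaretTree
  | vert (left right : CaretTree) : CaretTree
  | horiz (bottom top : CaretTree) : CaretTree

namespace CaretTree

/-- The number of carets (interior nodes). -/
def carets : CaretTree → ℕ
  | leaf => 0
  | vert l r => l.carets + r.carets + 1
  | horiz b t => b.carets + t.carets + 1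

/-- The type of leaves of a tree. -/
def Leaf : CaretTree → Type
  | leaf => Unit
  | vert l r => l.Leaf ⊕ r.Leaf
  | horiz b t => b.Leaf ⊕ t.Leaf

/-- The number of leaves. -/
def leafCount : CaretTree → ℕ
  | leaf => 1
  | vert l r => l.leafCount + r.leafCount
  | horiz b t => b.leafCount + t.leafCount

/-- The left-to-right numbering of the leaves, starting from `0`. -/
def index : (T : CaretTree) → T.Leaf ≃ Fin T.leafCount
  | leaf => (Equiv.equivPUnit (Fin 1)).symm
  | vert l r => (Equiv.sumCongr l.index r.index).trans finSumFinEquiv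
  | horiz b t => (Equiv.sumCongr b.index t.index).trans finSumFinEquiv

/-- `T.leafMap i` is the affine orientation-preserving (coordinatewise increasing) bijection of
the unit square onto the dyadic rectangle that corresponds to the leaf `i` of `T`. -/
noncomputable def leafMap : (T : CaretTree) → T.Leaf → Square → Square
  | leaf, _, p => p
  | vert l _, Sum.inl i, p => leftMap (leafMap l i p)
  | vert _ r, Sum.inr i, p => rightMap (leafMap r i p)
  | horiz b _, Sum.inl i, p => bottomMap (leafMap b i p)
  | horiz _ t, Sum.inr i, p => topMap (leafMap t i p)

end CaretTree

theorem lowHalf_injective : Function.Injective lowHalf := by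
  intro a b h
  have h' := congrArg Subtype.val h
  simp only [lowHalf] at h'
  exact Subtype.ext (by linarith)

theorem highHalf_injective : Function.Injective highHalf := by
  intro a b h
  have h' := congrArg Subtype.val h
  simp only [highHalf] at h'
  exact Subtype.ext (by linarith)

theorem lowHalf_ne_highHalf (a b : UnitIoc) : lowHalf a ≠ highHalf b := by
  intro h
  have h' := congrArg Subtype.val h
  simp only [lowHalf, highHalf] at h'
  have := a.2.2
  have := b.2.1
  linarith

theorem exists_half (t : UnitIoc) : (∃ s, lowHalf s = t) ∨ ∃ s, highHalf s = t := by
  have h0 := t.2.1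
  have h1 := t.2.2
  rcases le_or_gt (t : ℝ) (1 / 2) with h | h
  · exact Or.inl ⟨⟨2 * (t : ℝ), by constructor <;> linarith⟩, Subtype.ext (by simp [lowHalf])⟩
  · exact Or.inr ⟨⟨2 * (t : ℝ) - 1, by constructor <;> linarith⟩,
      Subtype.ext (by simp [highHalf])⟩

theorem leftMap_injective : Function.Injective leftMap := by
  rintro ⟨a, b⟩ ⟨c, d⟩ h
  obtain ⟨h1, h2⟩ := Prod.mk.inj h
  exact Prod.ext (lowHalf_injective h1) h2

theorem rightMap_injective : Function.Injective rightMap := by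
  rintro ⟨a, b⟩ ⟨c, d⟩ h
  obtain ⟨h1, h2⟩ := Prod.mk.inj h
  exact Prod.ext (highHalf_injective h1) h2

theorem bottomMap_injective : Function.Injective bottomMap := by
  rintro ⟨a, b⟩ ⟨c, d⟩ h
  obtain ⟨h1, h2⟩ := Prod.mk.inj h
  exact Prod.ext h1 (lowHalf_injective h2)

theorem topMap_injective : Function.Injective topMap := by
  rintro ⟨a, b⟩ ⟨c, d⟩ h
  obtain ⟨h1, h2⟩ := Prod.mk.inj h
  exact Prod.ext h1 (highHalf_injective h2)

theorem leftMap_ne_rightMap (p q : Square) : leftMap p ≠ rightMap q := fun h =>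
  lowHalf_ne_highHalf _ _ (congrArg Prod.fst h)

theorem bottomMap_ne_topMap (p q : Square) : bottomMap p ≠ topMap q := fun h =>
  lowHalf_ne_highHalf _ _ (congrArg Prod.snd h)

namespace CaretTree

/-- The rectangles of the leaves of a tree partition the square. -/
theorem leafMap_bijective (T : CaretTree) :
    Function.Bijective (fun z : T.Leaf × Square => T.leafMap z.1 z.2) := by
  induction T with
  | leaf =>
    refine ⟨?_, fun p => ⟨((), p), rfl⟩⟩
    rintro ⟨⟨⟩, p⟩ ⟨⟨⟩, q⟩ h
    exact Prod.ext rfl h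
  | vert l r hl hr =>
    constructor
    · rintro ⟨i | i, p⟩ ⟨j | j, q⟩ h
      · have := hl.1 (a₁ := (i, p)) (a₂ := (j, q)) (leftMap_injective h)
        simp only [Prod.mk.injEq] at this
        rw [this.1, this.2]
      · exact absurd h (leftMap_ne_rightMap _ _)
      · exact absurd h.symm (leftMap_ne_rightMap _ _)
      · have := hr.1 (a₁ := (i, p)) (a₂ := (j, q)) (rightMap_injective h)
        simp only [Prod.mk.injEq] at this
        rw [this.1, this.2]
    · rintro ⟨x, y⟩
      rcases exists_half x with ⟨s, rfl⟩ | ⟨s, rfl⟩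
      · obtain ⟨⟨i, p⟩, h⟩ := hl.2 (s, y)
        exact ⟨(Sum.inl i, p), congrArg leftMap h⟩
      · obtain ⟨⟨i, p⟩, h⟩ := hr.2 (s, y)
        exact ⟨(Sum.inr i, p), congrArg rightMap h⟩
  | horiz b t hb ht =>
    constructor
    · rintro ⟨i | i, p⟩ ⟨j | j, q⟩ h
      · have := hb.1 (a₁ := (i, p)) (a₂ := (j, q)) (bottomMap_injective h)
        simp only [Prod.mk.injEq] at this
        rw [this.1, this.2]
      · exact absurd h (bottomMap_ne_topMap _ _)
      · exact absurd h.symm (bottomMap_ne_topMap _ _)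
      · have := ht.1 (a₁ := (i, p)) (a₂ := (j, q)) (topMap_injective h)
        simp only [Prod.mk.injEq] at this
        rw [this.1, this.2]
    · rintro ⟨x, y⟩
      rcases exists_half y with ⟨s, rfl⟩ | ⟨s, rfl⟩
      · obtain ⟨⟨i, p⟩, h⟩ := hb.2 (x, s)
        exact ⟨(Sum.inl i, p), congrArg bottomMap h⟩
      · obtain ⟨⟨i, p⟩, h⟩ := ht.2 (x, s)
        exact ⟨(Sum.inr i, p), congrArg topMap h⟩

/-- The chart `(i, p) ↦ T.leafMap i p` as an equivalence. -/
noncomputable def chart (T : CaretTree) : T.Leaf × Square ≃ Square :=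
  Equiv.ofBijective _ T.leafMap_bijective

theorem chart_apply (T : CaretTree) (i : T.Leaf) (p : Square) :
    T.chart (i, p) = T.leafMap i p := rfl

end CaretTree

/-! ## Tree-pair diagrams -/

/-- A tree-pair diagram `(T₊, π, T₋)`: two trees and a bijection between their leaves (so the two
trees have the same number of leaves, hence the same number of carets). -/
structure TreePair : Type where
  source : CaretTree
  target : CaretTree
  perm : source.Leaf ≃ target.Leaf

namespace TreePair

/-- The number of carets of a tree-pair diagram: the common number of carets of its two trees. -/
def carets (P : TreePair) : ℕ := P.source.carets

/-- The dyadic self-bijection of the square given by a tree-pair diagram: it sends the rectangle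
of each leaf `i` of the source tree onto the rectangle of the leaf `P.perm i` of the target tree,
by the affine orientation-preserving map. -/
noncomputable def toPerm (P : TreePair) : Equiv.Perm Square :=
  P.source.chart.symm.trans ((Equiv.prodCongr P.perm (Equiv.refl Square)).trans P.target.chart)

theorem toPerm_leafMap (P : TreePair) (i : P.source.Leaf) (p : Square) :
    P.toPerm (P.source.leafMap i p) = P.target.leafMap (P.perm i) p := by
  rw [← CaretTree.chart_apply, ← CaretTree.chart_apply]
  simp [toPerm]

theorem toPerm_eq_of (P : TreePair) (f : Equiv.Perm Square)
    (h : ∀ i p, f (P.source.leafMap i p) = P.target.leafMap (P.perm i) p) : P.toPerm = f := by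
  ext1 x
  obtain ⟨⟨i, p⟩, rfl⟩ := P.source.leafMap_bijective.2 x
  exact (P.toPerm_leafMap i p).trans (h i p).symm

end TreePair

/-! ## Common refinements: the dyadic self-bijections form a group -/

namespace CaretTree

/-- `T.GraftsTo c W`: grafting the tree `c i` at each leaf `i` of `T` gives the same partition of
the square as `W`. -/
def GraftsTo (T : CaretTree) (c : T.Leaf → CaretTree) (W : CaretTree) : Prop :=
  ∃ e : (Σ i, (c i).Leaf) ≃ W.Leaf,
    ∀ i k p, W.leafMap (e ⟨i, k⟩) p = T.leafMap i ((c i).leafMap k p)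

/-- `W` is, as a partition of the square, obtained from `T` by further subdivisions. -/
def Refines (T W : CaretTree) : Prop := ∃ c, T.GraftsTo c W

theorem exists_graftsTo (T : CaretTree) (c : T.Leaf → CaretTree) : ∃ W, T.GraftsTo c W := by
  induction T with
  | leaf =>
    refine ⟨c (), ⟨⟨fun z => z.2, fun k => ⟨(), k⟩, fun z => rfl, fun k => rfl⟩, ?_⟩⟩
    intro i k p
    rfl
  | vert l r hl hr =>
    obtain ⟨A, a, ha⟩ := hl (fun i => c (Sum.inl i))
    obtain ⟨B, b, hb⟩ := hr (fun i => c (Sum.inr i))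
    refine ⟨vert A B, (Equiv.sumSigmaDistrib (fun i : l.Leaf ⊕ r.Leaf => (c i).Leaf)).trans
      (Equiv.sumCongr a b), ?_⟩
    rintro (i | i) k p
    · exact congrArg leftMap (ha i k p)
    · exact congrArg rightMap (hb i k p)
  | horiz l r hl hr =>
    obtain ⟨A, a, ha⟩ := hl (fun i => c (Sum.inl i))
    obtain ⟨B, b, hb⟩ := hr (fun i => c (Sum.inr i))
    refine ⟨horiz A B, (Equiv.sumSigmaDistrib (fun i : l.Leaf ⊕ r.Leaf => (c i).Leaf)).trans
      (Equiv.sumCongr a b), ?_⟩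
    rintro (i | i) k p
    · exact congrArg bottomMap (ha i k p)
    · exact congrArg topMap (hb i k p)

theorem Refines.of_equiv {T W : CaretTree} (e : T.Leaf ≃ W.Leaf)
    (h : ∀ i p, W.leafMap (e i) p = T.leafMap i p) : Refines T W :=
  ⟨fun _ => leaf, ⟨⟨fun z => e z.1, fun j => ⟨e.symm j, ()⟩,
    fun z => by rcases z with ⟨i, ⟨⟩⟩; simp, fun j => by simp⟩, fun i _ p => h i p⟩⟩

theorem Refines.refl (T : CaretTree) : Refines T T := .of_equiv (Equiv.refl _) fun _ _ => rfl

theorem leaf_refines (T : CaretTree) : Refines leaf T :=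
  ⟨fun _ => T, ⟨⟨fun z => z.2, fun k => ⟨(), k⟩, fun _ => rfl, fun _ => rfl⟩, fun _ _ _ => rfl⟩⟩

theorem Refines.vert {l r l' r' : CaretTree} (hl : Refines l l') (hr : Refines r r') :
    Refines (vert l r) (vert l' r') := by
  obtain ⟨c, a, ha⟩ := hl
  obtain ⟨d, b, hb⟩ := hr
  refine ⟨fun i => Sum.elim c d i,
    (Equiv.sumSigmaDistrib (fun i : l.Leaf ⊕ r.Leaf => (Sum.elim c d i).Leaf)).trans
      (Equiv.sumCongr a b), ?_⟩
  rintro (i | i) k p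
  · exact congrArg leftMap (ha i k p)
  · exact congrArg rightMap (hb i k p)

theorem Refines.horiz {l r l' r' : CaretTree} (hl : Refines l l') (hr : Refines r r') :
    Refines (horiz l r) (horiz l' r') := by
  obtain ⟨c, a, ha⟩ := hl
  obtain ⟨d, b, hb⟩ := hr
  refine ⟨fun i => Sum.elim c d i,
    (Equiv.sumSigmaDistrib (fun i : l.Leaf ⊕ r.Leaf => (Sum.elim c d i).Leaf)).trans
      (Equiv.sumCongr a b), ?_⟩
  rintro (i | i) k p
  · exact congrArg bottomMap (ha i k p)
  · exact congrArg topMap (hb i k p)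

theorem Refines.trans {T U W : CaretTree} (h : Refines T U) (h' : Refines U W) :
    Refines T W := by
  obtain ⟨c, a, ha⟩ := h
  obtain ⟨d, b, hb⟩ := h'
  choose X x hx using fun i => exists_graftsTo (c i) (fun k => d (a ⟨i, k⟩))
  refine ⟨X, ((Equiv.sigmaCongrRight fun i => (x i).symm).trans
    ((Equiv.sigmaAssoc (fun i k => (d (a ⟨i, k⟩)).Leaf)).symm.trans
      (Equiv.sigmaCongrLeft a (β := fun j => (d j).Leaf)))).trans b, ?_⟩
  intro i k p
  obtain ⟨⟨m, n⟩, rfl⟩ := (x i).surjective k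
  rw [hx, ← ha, ← hb]
  simp [Equiv.sigmaAssoc, Equiv.sigmaCongrLeft]

theorem swap_refines (p q r s : CaretTree) :
    Refines (vert (horiz p q) (horiz r s)) (horiz (vert p r) (vert q s)) :=
  .of_equiv (Equiv.sumSumSumComm p.Leaf q.Leaf r.Leaf s.Leaf)
    (by rintro ((i | i) | (i | i)) x <;> rfl)

theorem swap_refines' (p q r s : CaretTree) :
    Refines (horiz (vert p q) (vert r s)) (vert (horiz p r) (horiz q s)) :=
  .of_equiv (Equiv.sumSumSumComm p.Leaf q.Leaf r.Leaf s.Leaf)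
    (by rintro ((i | i) | (i | i)) x <;> rfl)

theorem exists_refines_vert (T : CaretTree) : ∃ l r, Refines T (vert l r) := by
  induction T with
  | leaf => exact ⟨leaf, leaf, leaf_refines _⟩
  | vert l r _ _ => exact ⟨l, r, .refl _⟩
  | horiz b t hb ht =>
    obtain ⟨p, q, h⟩ := hb
    obtain ⟨r, s, h'⟩ := ht
    exact ⟨_, _, (h.horiz h').trans (swap_refines' _ _ _ _)⟩

theorem exists_refines_horiz (T : CaretTree) : ∃ l r, Refines T (horiz l r) := by
  induction T with
  | leaf => exact ⟨leaf, leaf, leaf_refines _⟩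
  | horiz l r _ _ => exact ⟨l, r, .refl _⟩
  | vert b t hb ht =>
    obtain ⟨p, q, h⟩ := hb
    obtain ⟨r, s, h'⟩ := ht
    exact ⟨_, _, (h.vert h').trans (swap_refines _ _ _ _)⟩

/-- Any two trees have a common refinement. -/
theorem exists_common_refinement (T S : CaretTree) : ∃ W, Refines T W ∧ Refines S W := by
  induction T generalizing S with
  | leaf => exact ⟨S, leaf_refines S, .refl S⟩
  | vert l r hl hr =>
    obtain ⟨a, b, h⟩ := exists_refines_vert S
    obtain ⟨A, hA, hA'⟩ := hl a
    obtain ⟨B, hB, hB'⟩ := hr b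
    exact ⟨vert A B, hA.vert hB, h.trans (hA'.vert hB')⟩
  | horiz l r hl hr =>
    obtain ⟨a, b, h⟩ := exists_refines_horiz S
    obtain ⟨A, hA, hA'⟩ := hl a
    obtain ⟨B, hB, hB'⟩ := hr b
    exact ⟨horiz A B, hA.horiz hB, h.trans (hA'.horiz hB')⟩

end CaretTree

namespace TreePair

/-- The diagram with the two trees exchanged. -/
def symm (P : TreePair) : TreePair := ⟨P.target, P.source, P.perm.symm⟩

theorem symm_toPerm (P : TreePair) : P.symm.toPerm = P.toPerm⁻¹ := by
  refine toPerm_eq_of _ _ fun i p => ?_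
  rw [Equiv.Perm.inv_eq_iff_eq]
  have h1 := P.toPerm_leafMap (P.perm.symm i) p
  have h2 : P.perm (P.perm.symm i) = i := P.perm.apply_symm_apply i
  rw [h2] at h1
  exact h1.symm

theorem exists_source {P : TreePair} {W : CaretTree} (h : P.source.Refines W) :
    ∃ Q : TreePair, Q.source = W ∧ Q.toPerm = P.toPerm := by
  obtain ⟨c, a, ha⟩ := h
  obtain ⟨X, x, hx⟩ := CaretTree.exists_graftsTo P.target (fun j => c (P.perm.symm j))
  have key : ∀ j : (Σ i, (c i).Leaf), ∃ k : X.Leaf, ∀ p,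
      P.toPerm (W.leafMap (a j) p) = X.leafMap k p := by
    rintro ⟨i, k⟩
    obtain ⟨j, rfl⟩ := P.perm.symm.surjective i
    refine ⟨x ⟨j, k⟩, fun p => ?_⟩
    rw [ha, hx, toPerm_leafMap, Equiv.apply_symm_apply]
  refine ⟨⟨W, X, a.symm.trans
    ((Equiv.sigmaCongrLeft P.perm.symm (β := fun i => (c i).Leaf)).symm.trans x)⟩, rfl, ?_⟩
  refine toPerm_eq_of _ _ fun m p => ?_
  obtain ⟨j, rfl⟩ := a.surjective m
  obtain ⟨⟨j, k⟩, rfl⟩ :=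
    (Equiv.sigmaCongrLeft P.perm.symm (β := fun i => (c i).Leaf)).surjective j
  simp only [Equiv.trans_apply, Equiv.symm_apply_apply, hx]
  have h2 : (Equiv.sigmaCongrLeft P.perm.symm (β := fun i => (c i).Leaf)) ⟨j, k⟩
      = ⟨P.perm.symm j, k⟩ := rfl
  rw [h2, ha, toPerm_leafMap, Equiv.apply_symm_apply]

theorem exists_mul (P Q : TreePair) : ∃ R : TreePair, R.toPerm = P.toPerm * Q.toPerm := by
  obtain ⟨W, hP, hQ⟩ := CaretTree.exists_common_refinement P.source Q.target
  obtain ⟨⟨_, A, σ⟩, rfl, h1⟩ := exists_source hP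
  obtain ⟨⟨_, B, τ⟩, rfl, h2⟩ := exists_source (P := Q.symm) hQ
  have h3 : Q.toPerm = (⟨B, _, τ.symm⟩ : TreePair).toPerm := by
    rw [symm_toPerm, ← inv_eq_iff_eq_inv, ← symm_toPerm] at h2
    exact h2.symm
  refine ⟨⟨B, A, τ.symm.trans σ⟩, toPerm_eq_of _ _ fun i p => ?_⟩
  rw [Equiv.Perm.mul_apply, h3, ← h1]
  exact (congrArg _ (toPerm_leafMap ⟨B, _, τ.symm⟩ i p)).trans (toPerm_leafMap _ _ _)

end TreePair

/-- The group `2V` of dyadic self-bijections of the unit square, i.e. the maps given by tree-pair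
diagrams, under composition. -/
def twoV : Subgroup (Equiv.Perm Square) where
  carrier := Set.range TreePair.toPerm
  mul_mem' := by
    rintro _ _ ⟨P, rfl⟩ ⟨Q, rfl⟩
    exact P.exists_mul Q
  one_mem' := ⟨⟨.leaf, .leaf, Equiv.refl _⟩, TreePair.toPerm_eq_of _ _ fun _ _ => rfl⟩
  inv_mem' := by
    rintro _ ⟨P, rfl⟩
    exact ⟨P.symm, P.symm_toPerm⟩

/-- The element of `2V` given by a tree-pair diagram. -/
noncomputable def TreePair.toTwoV (P : TreePair) : twoV := ⟨P.toPerm, P, rfl⟩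

/-- `N(x)`: the number of carets in a minimal size tree-pair diagram of `x`. -/
noncomputable def caretNumber (x : twoV) : ℕ :=
  sInf {n : ℕ | ∃ P : TreePair, P.toTwoV = x ∧ P.carets = n}

/-! ## The standard generators -/

namespace CaretTree

/-- `spine n T`: the all-right tree with `n` vertical carets, with `T` hung from its last leaf. -/
def spine : ℕ → CaretTree → CaretTree
  | 0, T => T
  | n + 1, T => vert leaf (spine n T)

theorem leafCount_spine (n : ℕ) (T : CaretTree) :
    (spine n T).leafCount = n + T.leafCount := by
  induction n with
  | zero => simp [spine]
  | succ n ih => simp only [spine, leafCount, ih]; omega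

/-- The all-right tree with `n` carets, all of them vertical. -/
def allRight (n : ℕ) : CaretTree := spine n leaf

theorem leafCount_allRight (n : ℕ) : (allRight n).leafCount = n + 1 := leafCount_spine n leaf

end CaretTree

open CaretTree in
/-- The diagram `(T₊, id, T₋)`: the `i`-th leaf of `T₊` goes to the `i`-th leaf of `T₋`. -/
def orderedPair (S T : CaretTree) (h : S.leafCount = T.leafCount) : TreePair :=
  ⟨S, T, S.index.trans ((finCongr h).trans T.index.symm)⟩

/-- The diagram `(T, (i j), T)`: the `i`-th and `j`-th leaves of `T` are exchanged. -/
def swapPair (T : CaretTree) (i j : Fin T.leafCount) : TreePair :=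
  ⟨T, T, T.index.trans ((Equiv.swap i j).trans T.index.symm)⟩

open CaretTree in
/-- `A n`: a vertical caret hung from the leaf numbered `n` of the all-right vertical tree with
`n + 1` carets, against the all-right vertical tree with `n + 2` carets. -/
noncomputable def genA (n : ℕ) : twoV :=
  (orderedPair (spine n (vert (vert leaf leaf) leaf)) (allRight (n + 2))
    (by rw [leafCount_spine, leafCount_allRight]; rfl)).toTwoV

open CaretTree in
/-- `B n`: as `A n`, with a horizontal caret hung from the leaf numbered `n`. -/
noncomputable def genB (n : ℕ) : twoV :=
  (orderedPair (spine n (vert (horiz leaf leaf) leaf)) (allRight (n + 2))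
    (by rw [leafCount_spine, leafCount_allRight]; rfl)).toTwoV

open CaretTree in
/-- `C n`: the all-right tree with `n + 1` carets of which the last one is horizontal, against the
all-right vertical tree. In particular `C 0` is the baker's map. -/
noncomputable def genC (n : ℕ) : twoV :=
  (orderedPair (spine n (horiz leaf leaf)) (allRight (n + 1))
    (by rw [leafCount_spine, leafCount_allRight]; rfl)).toTwoV

open CaretTree in
/-- `π n`: exchanges the leaves `n` and `n + 1` of the all-right vertical tree with leaves
`0, …, n + 2`. -/
noncomputable def genPi (n : ℕ) : twoV :=
  (swapPair (allRight (n + 2)) ⟨n, by rw [leafCount_allRight]; omega⟩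
    ⟨n + 1, by rw [leafCount_allRight]; omega⟩).toTwoV

open CaretTree in
/-- `π̄ n`: exchanges the last two leaves `n` and `n + 1` of the all-right vertical tree with
leaves `0, …, n + 1`. -/
noncomputable def genPiBar (n : ℕ) : twoV :=
  (swapPair (allRight (n + 1)) ⟨n, by rw [leafCount_allRight]; omega⟩
    ⟨n + 1, by rw [leafCount_allRight]; omega⟩).toTwoV

/-- The standard finite generating set of `2V`. -/
def stdGenerators : Set twoV :=
  {genA 0, genA 1, genB 0, genB 1, genC 0, genC 1, genPi 0, genPi 1, genPiBar 0, genPiBar 1}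

/-! ## Word length -/

/-- The word length of `x` with respect to `S`: the least length of a word in the elements of `S`
and their inverses that represents `x`. -/
noncomputable def wordLength {G : Type*} [Group G] (S : Set G) (x : G) : ℕ :=
  sInf {n : ℕ | ∃ w : List G, (∀ g ∈ w, g ∈ S ∨ g⁻¹ ∈ S) ∧ w.prod = x ∧ w.length = n}

end BrinThompson

/-! Upper bound and generation. Number the nodes of the infinite binary tree breadth-first; for each
`n` the nodes `n, …, 2n - 1` are the leaves of a tree and give a balanced partition of the square
into `n` vertical strips of depth at most `log₂ n + 1`. Two disjoint strips can be exchanged by a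
word of length linear in their depths (`exists_hasWord_exchange`), so an exchange of two balanced
strips costs `O(log n)`. Passing from `n` to `n + 1` just halves strip `n`. Hence any tree can be
grown out of the balanced partition one caret at a time: an exchange brings the piece to be cut to
position `n`, and for a horizontal caret a copy of the inverse baker's map turns left and right into
bottom and top (`Reaches.exists_tree`). Doing this for both trees of a diagram leaves a permutation
of the balanced strips, which is a product of at most `n` exchanges
(`exists_hasWord_of_permutes_addr`). Everything together costs `O(n log n)`, and in particular the
standard set generates.

Lower bound. Trees with `a` and `b` leaves have a common refinement with at most `a * b` leaves, so
the leaf number `N + 1` is submultiplicative (`caretNumber_mul_add_one_le`) and grows at most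
exponentially with the word length.

Baker's map. `C₀` moves the leading binary digit of the second coordinate to the front of the first.
A rectangle on which `C₀ⁿ` is affine must therefore fix `n` digits of the second coordinate; its
area is at most `2⁻ⁿ`, which forces `2ⁿ` leaves.

Genericity. The permutations of the leaves of the all-right tree with `n` carets that send the last
leaf to the first cannot be represented with fewer carets (`caretNumber_permPair`); thus at least
`n!` elements have `N = n`. A ball of radius `L` has at most `q ^ L` elements, and for `L ≤ c n log
n` with `c` small this is an exponentially small fraction of `n!`. -/

namespace BrinThompson

open CaretTree

/-! ## Dyadic intervals as binary words -/

/-- The two halvings of the interval, indexed by binary digits. -/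
noncomputable def half (b : Bool) : UnitIoc → UnitIoc := if b then highHalf else lowHalf

@[simp] theorem half_false : half false = lowHalf := rfl

@[simp] theorem half_true : half true = highHalf := rfl

theorem half_eq_half {a b : Bool} {s t : UnitIoc} : half a s = half b t ↔ a = b ∧ s = t := by
  constructor
  · intro h
    cases a <;> cases b
    · exact ⟨rfl, lowHalf_injective h⟩
    · exact absurd h (lowHalf_ne_highHalf _ _)
    · exact absurd h.symm (lowHalf_ne_highHalf _ _)
    · exact ⟨rfl, highHalf_injective h⟩
  · rintro ⟨rfl, rfl⟩
    rfl

theorem exists_half_eq (t : UnitIoc) : ∃ b s, half b s = t := by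
  rcases exists_half t with h | h
  · exact ⟨false, h⟩
  · exact ⟨true, h⟩

/-- The increasing affine bijection of the interval onto the dyadic interval with the given binary
digits. -/
noncomputable def word : List Bool → UnitIoc → UnitIoc
  | [], t => t
  | b :: u, t => half b (word u t)

@[simp] theorem word_nil (t : UnitIoc) : word [] t = t := rfl

@[simp] theorem word_cons (b : Bool) (u : List Bool) (t : UnitIoc) :
    word (b :: u) t = half b (word u t) := rfl

theorem word_append (u v : List Bool) (t : UnitIoc) : word (u ++ v) t = word u (word v t) := by
  induction u with
  | nil => rfl
  | cons b u ih => simp [ih]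

theorem word_injective (u : List Bool) : Function.Injective (word u) := by
  induction u with
  | nil => exact fun _ _ h => h
  | cons b u ih => exact fun _ _ h => ih (half_eq_half.1 h).2

theorem prefix_or_prefix_of_word_eq {u v : List Bool} {s t : UnitIoc}
    (h : word u s = word v t) : u <+: v ∨ v <+: u := by
  induction u generalizing v with
  | nil => exact Or.inl v.nil_prefix
  | cons a u ih =>
    cases v with
    | nil => exact Or.inr (List.nil_prefix)
    | cons b v =>
      obtain ⟨rfl, h'⟩ := half_eq_half.1 h
      simpa using ih h'

/-- A point of the interval. -/
noncomputable def unitPt : UnitIoc := ⟨1, by norm_num⟩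

theorem eq_of_word_eq {u v : List Bool} (h : ∀ t, word u t = word v t) : u = v := by
  induction u generalizing v with
  | nil =>
    cases v with
    | nil => rfl
    | cons b v =>
      -- A point whose first digit is `!b` is not in the image of `word (b :: v)`, all of whose
      -- points have first digit `b`.
      have := (half_eq_half.1 (h (half (!b) unitPt))).1
      cases b <;> cases this
  | cons a u ih =>
    cases v with
    | nil =>
      have := (half_eq_half.1 (h (half (!a) unitPt))).1
      cases a <;> cases this
    | cons b v =>
      obtain ⟨rfl, -⟩ := half_eq_half.1 (h unitPt)
      rw [ih fun t => (half_eq_half.1 (h t)).2]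

/-! ## The words of a leaf -/

namespace CaretTree

/-- The digits of the first side of the rectangle of a leaf. -/
def xWord : (T : CaretTree) → T.Leaf → List Bool
  | leaf, _ => []
  | vert l _, Sum.inl i => false :: xWord l i
  | vert _ r, Sum.inr i => true :: xWord r i
  | horiz b _, Sum.inl i => xWord b i
  | horiz _ t, Sum.inr i => xWord t i

/-- The digits of the second side of the rectangle of a leaf. -/
def yWord : (T : CaretTree) → T.Leaf → List Bool
  | leaf, _ => []
  | vert l _, Sum.inl i => yWord l i
  | vert _ r, Sum.inr i => yWord r i
  | horiz b _, Sum.inl i => false :: yWord b i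
  | horiz _ t, Sum.inr i => true :: yWord t i

theorem leafMap_eq (T : CaretTree) (i : T.Leaf) (p : Square) :
    T.leafMap i p = (word (T.xWord i) p.1, word (T.yWord i) p.2) := by
  induction T with
  | leaf => rfl
  | vert l r hl hr =>
    rcases i with i | i
    · simp [leafMap, hl, leftMap, xWord, yWord]
    · simp [leafMap, hr, rightMap, xWord, yWord]
  | horiz l r hl hr =>
    rcases i with i | i
    · simp [leafMap, hl, bottomMap, xWord, yWord]
    · simp [leafMap, hr, topMap, xWord, yWord]

/-- Trees have finitely many leaves. -/
instance instFintypeLeaf : (T : CaretTree) → Fintype T.Leaf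
  | leaf => inferInstanceAs (Fintype Unit)
  | vert l r =>
    letI := instFintypeLeaf l
    letI := instFintypeLeaf r
    inferInstanceAs (Fintype (l.Leaf ⊕ r.Leaf))
  | horiz l r =>
    letI := instFintypeLeaf l
    letI := instFintypeLeaf r
    inferInstanceAs (Fintype (l.Leaf ⊕ r.Leaf))

theorem card_leaf (T : CaretTree) : Fintype.card T.Leaf = T.leafCount := by
  simpa using Fintype.card_congr T.index

theorem leafCount_eq (T : CaretTree) : T.leafCount = T.carets + 1 := by
  induction T with
  | leaf => rfl
  | vert l r hl hr => simp only [leafCount, carets, hl, hr]; omega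
  | horiz l r hl hr => simp only [leafCount, carets, hl, hr]; omega

theorem sum_leaf {M : Type*} [AddCommMonoid M] (f : leaf.Leaf → M) : ∑ i, f i = f () :=
  Fintype.sum_unique (ι := Unit) f

theorem sum_vert {M : Type*} [AddCommMonoid M] (l r : CaretTree) (f : (vert l r).Leaf → M) :
    ∑ i, f i = ∑ i : l.Leaf, f (Sum.inl i) + ∑ i : r.Leaf, f (Sum.inr i) :=
  Fintype.sum_sum_type (α₁ := l.Leaf) (α₂ := r.Leaf) f

theorem sum_horiz {M : Type*} [AddCommMonoid M] (l r : CaretTree) (f : (horiz l r).Leaf → M) :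
    ∑ i, f i = ∑ i : l.Leaf, f (Sum.inl i) + ∑ i : r.Leaf, f (Sum.inr i) :=
  Fintype.sum_sum_type (α₁ := l.Leaf) (α₂ := r.Leaf) f

/-- The rectangles of the leaves have total area one. -/
theorem sum_area (T : CaretTree) :
    ∑ i, (1 / 2 : ℝ) ^ ((T.xWord i).length + (T.yWord i).length) = 1 := by
  induction T with
  | leaf => rw [sum_leaf]; simp [xWord, yWord]
  | vert l r hl hr =>
    have e (m n : ℕ) : (1 / 2 : ℝ) ^ (m + 1 + n) = (1 / 2) ^ (m + n) * (1 / 2) := by ring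
    rw [sum_vert]
    simp only [xWord, yWord, List.length_cons, e]
    rw [← Finset.sum_mul, ← Finset.sum_mul, hl, hr]
    norm_num
  | horiz l r hl hr =>
    have e (m n : ℕ) : (1 / 2 : ℝ) ^ (m + (n + 1)) = (1 / 2) ^ (m + n) * (1 / 2) := by ring
    rw [sum_horiz]
    simp only [xWord, yWord, List.length_cons, e]
    rw [← Finset.sum_mul, ← Finset.sum_mul, hl, hr]
    norm_num

end CaretTree

/-! ## Words in a generating set -/

section Words

variable {G G' : Type*} [Group G] [Group G']

/-- `HasWord S k x`: the element `x` is represented by a word of length at most `k` in the elements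
of `S` and their inverses. -/
def HasWord (S : Set G) (k : ℕ) (x : G) : Prop :=
  ∃ w : List G, (∀ g ∈ w, g ∈ S ∨ g⁻¹ ∈ S) ∧ w.prod = x ∧ w.length ≤ k

namespace HasWord

variable {S : Set G} {k m : ℕ} {x y : G}

theorem one : HasWord S k 1 := ⟨[], by simp, rfl, Nat.zero_le _⟩

theorem of_mem (h : x ∈ S) : HasWord S 1 x := ⟨[x], by simp [h], by simp, le_rfl⟩

theorem mono (h : HasWord S k x) (hk : k ≤ m) : HasWord S m x := by
  obtain ⟨w, h1, h2, h3⟩ := h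
  exact ⟨w, h1, h2, h3.trans hk⟩

theorem mul (hx : HasWord S k x) (hy : HasWord S m y) : HasWord S (k + m) (x * y) := by
  obtain ⟨v, h1, rfl, h3⟩ := hx
  obtain ⟨w, h4, rfl, h6⟩ := hy
  refine ⟨v ++ w, fun g hg => ?_, by simp, by simp; omega⟩
  rcases List.mem_append.1 hg with hg | hg
  · exact h1 g hg
  · exact h4 g hg

theorem inv (hx : HasWord S k x) : HasWord S k x⁻¹ := by
  obtain ⟨v, h1, rfl, h3⟩ := hx
  refine ⟨(v.map (·⁻¹)).reverse, fun g hg => ?_, (List.prod_inv_reverse v).symm, by simpa⟩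
  simp only [List.mem_reverse, List.mem_map] at hg
  obtain ⟨a, ha, rfl⟩ := hg
  simpa [or_comm] using h1 a ha

theorem pow (hx : HasWord S k x) (n : ℕ) : HasWord S (n * k) (x ^ n) := by
  induction n with
  | zero => simpa using one
  | succ n ih => rw [pow_succ, Nat.succ_mul]; exact ih.mul hx

theorem mem_closure (hx : HasWord S k x) : x ∈ Subgroup.closure S := by
  obtain ⟨v, h1, rfl, h3⟩ := hx
  refine Subgroup.list_prod_mem _ fun g hg => ?_
  rcases h1 g hg with h | h
  · exact Subgroup.subset_closure h
  · simpa using Subgroup.inv_mem _ (Subgroup.subset_closure h)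

theorem exists_of_mem_closure (h : x ∈ Subgroup.closure S) : ∃ k, HasWord S k x := by
  induction h using Subgroup.closure_induction with
  | mem x hx => exact ⟨1, of_mem hx⟩
  | one => exact ⟨0, one⟩
  | mul x y _ _ hx hy => exact ⟨_, hx.choose_spec.mul hy.choose_spec⟩
  | inv x _ hx => exact ⟨_, hx.choose_spec.inv⟩

theorem wordLength_le (h : HasWord S k x) : wordLength S x ≤ k := by
  obtain ⟨w, h1, h2, h3⟩ := h
  refine le_trans (Nat.sInf_le ?_) h3
  exact ⟨w, h1, h2, rfl⟩

/-- A homomorphism changes word lengths by at most a bounded factor. -/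
theorem exists_map (φ : G →* G') {S' : Set G'} (hS : S.Finite)
    (hφ : ∀ s ∈ S, φ s ∈ Subgroup.closure S') :
    ∃ K, ∀ k x, HasWord S k x → HasWord S' (k * K) (φ x) := by
  have hK : ∀ s, ∃ k, s ∈ S → HasWord S' k (φ s) := fun s => by
    by_cases hs : s ∈ S
    · obtain ⟨k, hk⟩ := exists_of_mem_closure (hφ s hs)
      exact ⟨k, fun _ => hk⟩
    · exact ⟨0, fun h => absurd h hs⟩
  choose κ hκ using hK
  have hle : ∀ s ∈ S, HasWord S' (∑ s ∈ hS.toFinset, κ s) (φ s) := fun s hs =>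
    (hκ s hs).mono (Finset.single_le_sum (f := κ) (fun _ _ => Nat.zero_le _) (by simpa using hs))
  refine ⟨∑ s ∈ hS.toFinset, κ s, fun k x => ?_⟩
  rintro ⟨w, h1, rfl, h3⟩
  refine HasWord.mono (k := w.length * ∑ s ∈ hS.toFinset, κ s) ?_ (Nat.mul_le_mul_right _ h3)
  clear h3
  induction w with
  | nil => simpa using one
  | cons a w ih =>
    have ha : HasWord S' (∑ s ∈ hS.toFinset, κ s) (φ a) := by
      rcases h1 a List.mem_cons_self with h | h
      · exact hle a h
      · simpa using (hle _ h).inv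
    rw [List.prod_cons, map_mul]
    exact (ha.mul (ih fun g hg => h1 g (List.mem_cons_of_mem _ hg))).mono
      (by rw [List.length_cons]; ring_nf; exact le_rfl)

end HasWord

theorem hasWord_wordLength {S : Set G} {x : G} (h : x ∈ Subgroup.closure S) :
    HasWord S (wordLength S x) x := by
  obtain ⟨k, w, h1, h2, h3⟩ := HasWord.exists_of_mem_closure h
  obtain ⟨v, h4, h5, h6⟩ := Nat.sInf_mem
    (s := {n : ℕ | ∃ w : List G, (∀ g ∈ w, g ∈ S ∨ g⁻¹ ∈ S) ∧ w.prod = x ∧ w.length = n})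
    ⟨_, w, h1, h2, rfl⟩
  exact ⟨v, h4, h5, h6.le⟩

/-- Words are constructed among all bijections of the square, where copies in strips need no proof
of membership in `2V`; this lifts the finished words back to `2V`. -/
theorem HasWord.exists_preimage {S : Set G} (φ : G →* G') {k : ℕ} {y : G'}
    (h : HasWord (φ '' S) k y) : ∃ x, HasWord S k x ∧ φ x = y := by
  obtain ⟨w, h1, rfl, h3⟩ := h
  induction w generalizing k with
  | nil => exact ⟨1, .one, by simp⟩
  | cons a w ih =>
    obtain ⟨x, hx, hx'⟩ := ih (k := w.length) (fun g hg => h1 g (List.mem_cons_of_mem _ hg)) le_rfl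
    have : ∃ b, HasWord S 1 b ∧ φ b = a := by
      rcases h1 a List.mem_cons_self with ⟨b, hb, h⟩ | ⟨b, hb, h⟩
      · exact ⟨b, .of_mem hb, h⟩
      · exact ⟨b⁻¹, (HasWord.of_mem hb).inv, by rw [map_inv, h, inv_inv]⟩
    obtain ⟨b, hb, rfl⟩ := this
    refine ⟨b * x, (hb.mul hx).mono ?_, by simp [hx']⟩
    simp at h3; omega

/-- Word lengths for two finite generating sets are comparable. -/
theorem exists_wordLength_le_mul {S S' : Set G} (hS : S.Finite)
    (h : Subgroup.closure S = ⊤) (h' : Subgroup.closure S' = ⊤) :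
    ∃ K, ∀ x, wordLength S' x ≤ wordLength S x * K := by
  obtain ⟨K, hK⟩ := HasWord.exists_map (MonoidHom.id G) (S' := S') hS (by simp [h'])
  exact ⟨K, fun x => (hK _ _ (hasWord_wordLength (by simp [h]))).wordLength_le⟩

/-- The number of elements of a ball grows at most exponentially with the radius. -/
theorem exists_ncard_wordLength_le {S : Set G} (hS : S.Finite) (h : Subgroup.closure S = ⊤) :
    ∃ q : ℕ, 0 < q ∧ ∀ n, {x | wordLength S x ≤ n}.Finite ∧
      {x | wordLength S x ≤ n}.ncard ≤ q ^ n := by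
  -- With the identity as an additional letter, words of length at most `n` can be padded to length
  -- exactly `n`.
  have hfin : (insert 1 (S ∪ S⁻¹)).Finite := (hS.union hS.inv).insert 1
  have : Fintype (insert 1 (S ∪ S⁻¹) : Set G) := hfin.fintype
  set A : Set G := insert 1 (S ∪ S⁻¹)
  have : Nonempty A := ⟨⟨1, Set.mem_insert _ _⟩⟩
  refine ⟨Fintype.card A, Fintype.card_pos, fun n => ?_⟩
  let f : List.Vector A n → G := fun w => (w.toList.map Subtype.val).prod
  have key : {x | wordLength S x ≤ n} ⊆ Set.range f := by
    intro x hx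
    obtain ⟨w, h1, rfl, h3⟩ := (hasWord_wordLength (S := S) (x := x) (by simp [h])).mono hx
    have hw : ∀ g ∈ w ++ List.replicate (n - w.length) 1, g ∈ A := by
      intro g hg
      rcases List.mem_append.1 hg with hg | hg
      · exact Or.inr (by simpa using h1 g hg)
      · exact Or.inl (List.eq_of_mem_replicate hg)
    refine ⟨⟨(w ++ List.replicate (n - w.length) 1).attachWith _ hw, by simp; omega⟩, ?_⟩
    simp only [f, List.Vector.toList]
    rw [List.attachWith_map_subtype_val]
    simp
  refine ⟨(Set.finite_range f).subset key, (Set.ncard_le_ncard key (Set.finite_range f)).trans ?_⟩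
  rw [← Nat.card_coe_set_eq]
  refine (Nat.card_le_card_of_surjective _ Set.rangeFactorization_surjective).trans ?_
  simp [card_vector]

end Words

/-! ## Vertical strips and copies of maps in them -/

/-- The affine identification of the square with the vertical strip given by a binary word. -/
noncomputable def cone (u : List Bool) (p : Square) : Square := (word u p.1, p.2)

@[simp] theorem cone_nil (p : Square) : cone [] p = p := rfl

theorem cone_append (u v : List Bool) (p : Square) : cone (u ++ v) p = cone u (cone v p) := by
  simp [cone, word_append]

theorem cone_cons (b : Bool) (u : List Bool) (p : Square) :
    cone (b :: u) p = cone [b] (cone u p) := cone_append [b] u p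

theorem cone_injective (u : List Bool) : Function.Injective (cone u) := fun _ _ h =>
  Prod.ext (word_injective u (Prod.mk.inj h).1) (Prod.mk.inj h).2

theorem cone_false (p : Square) : cone [false] p = leftMap p := rfl

theorem cone_true (p : Square) : cone [true] p = rightMap p := rfl

theorem cone_singleton_ne {a b : Bool} (h : a ≠ b) (p q : Square) : cone [a] p ≠ cone [b] q :=
  fun e => h (half_eq_half.1 (Prod.mk.inj e).1).1

theorem exists_cone_singleton (p : Square) : ∃ b q, cone [b] q = p := by
  obtain ⟨b, s, h⟩ := exists_half_eq p.1
  exact ⟨b, (s, p.2), Prod.ext h rfl⟩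

/-- The copy in a vertical strip of a bijection of the square, extended by the identity. -/
noncomputable def copy (u : List Bool) : Equiv.Perm Square →* Equiv.Perm Square :=
  Equiv.Perm.viaEmbeddingHom ⟨cone u, cone_injective u⟩

theorem copy_cone (u : List Bool) (f : Equiv.Perm Square) (p : Square) :
    copy u f (cone u p) = cone u (f p) :=
  Equiv.Perm.viaEmbedding_apply f ⟨cone u, cone_injective u⟩ p

theorem copy_of_notMem {u : List Bool} (f : Equiv.Perm Square) {p : Square}
    (h : ∀ q, cone u q ≠ p) : copy u f p = p :=
  Equiv.Perm.viaEmbedding_apply_of_notMem f ⟨cone u, cone_injective u⟩ p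
    (by rintro ⟨q, hq⟩; exact h q hq)

theorem copy_eq {u : List Bool} {f g : Equiv.Perm Square} (h : ∀ p, g (cone u p) = cone u (f p))
    (h' : ∀ p, (∀ q, cone u q ≠ p) → g p = p) : copy u f = g := by
  ext1 p
  by_cases hp : ∃ q, cone u q = p
  · obtain ⟨q, rfl⟩ := hp
    rw [copy_cone, h]
  · rw [copy_of_notMem _ (by simpa using hp), h' _ (by simpa using hp)]

theorem copy_nil (f : Equiv.Perm Square) : copy [] f = f :=
  copy_eq (fun _ => rfl) fun p h => absurd rfl (h p)

theorem copy_append (u v : List Bool) (f : Equiv.Perm Square) :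
    copy (u ++ v) f = copy u (copy v f) := by
  refine copy_eq (fun p => ?_) fun p h => ?_
  · rw [cone_append, copy_cone, copy_cone, cone_append]
  · by_cases hp : ∃ q, cone u q = p
    · obtain ⟨q, rfl⟩ := hp
      rw [copy_cone, copy_of_notMem]
      rintro r rfl
      exact h r (cone_append _ _ _)
    · exact copy_of_notMem _ (by simpa using hp)

theorem perm_inv_apply_self {α : Type*} (g : Equiv.Perm α) (a : α) : g⁻¹ (g a) = a :=
  Equiv.Perm.inv_eq_iff_eq.2 rfl

/-- Nothing is required of `g` outside the strip `u`: as a bijection it maps the complement of `u`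
onto the complement of `v`, where the copy is the identity. -/
theorem copy_conj {u v : List Bool} {g : Equiv.Perm Square} (h : ∀ p, g (cone u p) = cone v p)
    (f : Equiv.Perm Square) : copy u f = g⁻¹ * copy v f * g := by
  refine copy_eq (fun p => ?_) fun p hp => ?_
  · simp only [Equiv.Perm.mul_apply]
    rw [h, copy_cone, Equiv.Perm.inv_eq_iff_eq, h]
  · simp only [Equiv.Perm.mul_apply]
    rw [copy_of_notMem, perm_inv_apply_self]
    intro q hq
    exact hp q (g.injective (by rw [h, hq]))

/-! ## Exchanging two strips -/

/-- `IsExchange u v t`: the map `t` exchanges two vertical strips and fixes all other points. -/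
structure IsExchange (u v : List Bool) (t : Equiv.Perm Square) : Prop where
  left (p : Square) : t (cone u p) = cone v p
  right (p : Square) : t (cone v p) = cone u p
  fixed (p : Square) (h : ∀ q, cone u q ≠ p) (h' : ∀ q, cone v q ≠ p) : t p = p

namespace IsExchange

variable {u v u' v' : List Bool} {t g : Equiv.Perm Square}

theorem symm (h : IsExchange u v t) : IsExchange v u t :=
  ⟨h.right, h.left, fun p h1 h2 => h.fixed p h2 h1⟩

theorem conj (h : IsExchange u v t) (hu : ∀ p, g (cone u' p) = cone u p)
    (hv : ∀ p, g (cone v' p) = cone v p) : IsExchange u' v' (g⁻¹ * t * g) where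
  left p := by
    simp only [Equiv.Perm.mul_apply]
    rw [hu, h.left, Equiv.Perm.inv_eq_iff_eq, hv]
  right p := by
    simp only [Equiv.Perm.mul_apply]
    rw [hv, h.right, Equiv.Perm.inv_eq_iff_eq, hu]
  fixed p h1 h2 := by
    simp only [Equiv.Perm.mul_apply]
    rw [h.fixed, perm_inv_apply_self]
    · exact fun q hq => h1 q (g.injective (by rw [hu, hq]))
    · exact fun q hq => h2 q (g.injective (by rw [hv, hq]))

theorem copy (h : IsExchange u v t) (w : List Bool) :
    IsExchange (w ++ u) (w ++ v) (copy w t) where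
  left p := by rw [cone_append, copy_cone, h.left, cone_append]
  right p := by rw [cone_append, copy_cone, h.right, cone_append]
  fixed p h1 h2 := by
    by_cases hp : ∃ q, cone w q = p
    · obtain ⟨q, rfl⟩ := hp
      rw [copy_cone, h.fixed]
      · rintro r rfl
        exact h1 r (cone_append _ _ _)
      · rintro r rfl
        exact h2 r (cone_append _ _ _)
    · exact copy_of_notMem _ (by simpa using hp)

end IsExchange

/-! ## The action of the generators -/

theorem toPerm_eq_copy {S T : CaretTree} (e : (vert leaf S).Leaf ≃ (vert leaf T).Leaf)
    (π : S.Leaf ≃ T.Leaf) (h0 : e (Sum.inl ()) = Sum.inl ())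
    (h1 : ∀ i, e (Sum.inr i) = Sum.inr (π i)) :
    (⟨vert leaf S, vert leaf T, e⟩ : TreePair).toPerm
      = copy [true] (⟨S, T, π⟩ : TreePair).toPerm := by
  refine TreePair.toPerm_eq_of _ _ ?_
  rintro (⟨⟩ | i) p
  · rw [copy_of_notMem]
    · exact congrArg (fun j => (vert leaf T).leafMap j p) h0.symm
    · exact fun q h => cone_singleton_ne (by simp) q p (h.trans (cone_false p).symm)
  · have := TreePair.toPerm_leafMap ⟨S, T, π⟩ i p
    calc copy [true] (⟨S, T, π⟩ : TreePair).toPerm (cone [true] (S.leafMap i p))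
        = cone [true] (T.leafMap (π i) p) := by rw [copy_cone, this]
      _ = (vert leaf T).leafMap (e (Sum.inr i)) p := by rw [h1]; rfl

theorem genA_one : (genA 1 : Equiv.Perm Square) = copy [true] (genA 0 : Equiv.Perm Square) :=
  toPerm_eq_copy _ _ rfl (by rintro ((⟨⟩ | ⟨⟩) | ⟨⟩) <;> rfl)

theorem genB_one : (genB 1 : Equiv.Perm Square) = copy [true] (genB 0 : Equiv.Perm Square) :=
  toPerm_eq_copy _ _ rfl (by rintro ((⟨⟩ | ⟨⟩) | ⟨⟩) <;> rfl)

theorem genC_one : (genC 1 : Equiv.Perm Square) = copy [true] (genC 0 : Equiv.Perm Square) :=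
  toPerm_eq_copy _ _ rfl (by rintro (⟨⟩ | ⟨⟩) <;> rfl)

theorem genPi_one : (genPi 1 : Equiv.Perm Square) = copy [true] (genPi 0 : Equiv.Perm Square) :=
  toPerm_eq_copy _ _ rfl (by rintro (⟨⟩ | (⟨⟩ | ⟨⟩)) <;> rfl)

theorem genPiBar_one :
    (genPiBar 1 : Equiv.Perm Square) = copy [true] (genPiBar 0 : Equiv.Perm Square) :=
  toPerm_eq_copy _ _ rfl (by rintro (⟨⟩ | ⟨⟩) <;> rfl)

theorem genA_zero_left (p : Square) :
    (genA 0 : Equiv.Perm Square) (cone [false, false] p) = cone [false] p :=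
  TreePair.toPerm_leafMap
    (orderedPair (spine 0 (vert (vert leaf leaf) leaf)) (allRight 2) rfl)
    (Sum.inl (Sum.inl ())) p

theorem genA_zero_middle (p : Square) :
    (genA 0 : Equiv.Perm Square) (cone [false, true] p) = cone [true, false] p :=
  TreePair.toPerm_leafMap
    (orderedPair (spine 0 (vert (vert leaf leaf) leaf)) (allRight 2) rfl)
    (Sum.inl (Sum.inr ())) p

theorem genA_zero_right (p : Square) :
    (genA 0 : Equiv.Perm Square) (cone [true] p) = cone [true, true] p :=
  TreePair.toPerm_leafMap
    (orderedPair (spine 0 (vert (vert leaf leaf) leaf)) (allRight 2) rfl)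
    (Sum.inr ()) p

theorem genC_zero_bottom (p : Square) :
    (genC 0 : Equiv.Perm Square) (bottomMap p) = leftMap p :=
  TreePair.toPerm_leafMap
    (orderedPair (spine 0 (horiz leaf leaf)) (allRight 1) rfl)
    (Sum.inl ()) p

theorem genC_zero_top (p : Square) :
    (genC 0 : Equiv.Perm Square) (topMap p) = rightMap p :=
  TreePair.toPerm_leafMap
    (orderedPair (spine 0 (horiz leaf leaf)) (allRight 1) rfl)
    (Sum.inr ()) p

theorem isExchange_genPi_zero : IsExchange [false] [true, false] (genPi 0 : Equiv.Perm Square) where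
  left p := TreePair.toPerm_leafMap (swapPair (allRight 2) (0 : Fin 3) (1 : Fin 3))
    (Sum.inl ()) p
  right p := TreePair.toPerm_leafMap (swapPair (allRight 2) (0 : Fin 3) (1 : Fin 3))
    (Sum.inr (Sum.inl ())) p
  fixed p h h' := by
    obtain ⟨b, q, rfl⟩ := exists_cone_singleton p
    cases b
    · exact absurd rfl (h q)
    · obtain ⟨b, q, rfl⟩ := exists_cone_singleton q
      cases b
      · exact absurd rfl (h' q)
      · exact TreePair.toPerm_leafMap
          (swapPair (allRight 2) (0 : Fin 3) (1 : Fin 3))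
          (Sum.inr (Sum.inr ())) q

theorem isExchange_genPiBar_zero : IsExchange [false] [true] (genPiBar 0 : Equiv.Perm Square) where
  left p := TreePair.toPerm_leafMap (swapPair (allRight 1) (0 : Fin 2) (1 : Fin 2))
    (Sum.inl ()) p
  right p := TreePair.toPerm_leafMap (swapPair (allRight 1) (0 : Fin 2) (1 : Fin 2))
    (Sum.inr ()) p
  fixed p h h' := by
    obtain ⟨b, q, rfl⟩ := exists_cone_singleton p
    cases b
    · exact absurd rfl (h q)
    · exact absurd rfl (h' q)

/-! ## The subgroup generated by the standard generators -/

/-- The standard generators as bijections of the square. -/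
def stdPerms : Set (Equiv.Perm Square) := twoV.subtype '' stdGenerators

theorem finite_stdPerms : stdPerms.Finite := by
  refine Set.Finite.image _ ?_
  simp only [stdGenerators]
  exact Set.toFinite _

theorem mem_closure_stdPerms {g : twoV} (h : g ∈ stdGenerators) :
    (g : Equiv.Perm Square) ∈ Subgroup.closure stdPerms :=
  Subgroup.subset_closure ⟨g, h, rfl⟩

/-- Copying in the right half turns the generators of index `0` into those of index `1`, and those
of index `1` into copies in the strip `[true, true]`. The latter are conjugates of the generators of
index `1` by `genA 0`, which maps the right half affinely onto that strip. -/
theorem copy_true_mem {f : Equiv.Perm Square} (hf : f ∈ Subgroup.closure stdPerms) :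
    copy [true] f ∈ Subgroup.closure stdPerms := by
  have hA : (genA 0 : Equiv.Perm Square) ∈ Subgroup.closure stdPerms :=
    mem_closure_stdPerms (by simp [stdGenerators])
  have second {g : Equiv.Perm Square} (hg : copy [true] g ∈ Subgroup.closure stdPerms) :
      copy [true] (copy [true] g) ∈ Subgroup.closure stdPerms := by
    rw [← copy_append]
    have h : copy ([true] ++ [true]) g
        = (genA 0 : Equiv.Perm Square) * copy [true] g * (genA 0 : Equiv.Perm Square)⁻¹ := by
      rw [copy_conj genA_zero_right g]
      group
      rfl
    rw [h]
    exact Subgroup.mul_mem _ (Subgroup.mul_mem _ hA hg) (Subgroup.inv_mem _ hA)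
  have : (Subgroup.closure stdPerms).map (copy [true]) ≤ Subgroup.closure stdPerms := by
    rw [MonoidHom.map_closure, Subgroup.closure_le]
    have a := mem_closure_stdPerms (g := genA 1) (by simp [stdGenerators])
    have b := mem_closure_stdPerms (g := genB 1) (by simp [stdGenerators])
    have c := mem_closure_stdPerms (g := genC 1) (by simp [stdGenerators])
    have d := mem_closure_stdPerms (g := genPi 1) (by simp [stdGenerators])
    have e := mem_closure_stdPerms (g := genPiBar 1) (by simp [stdGenerators])
    rw [genA_one] at a
    rw [genB_one] at b
    rw [genC_one] at c
    rw [genPi_one] at d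
    rw [genPiBar_one] at e
    rintro _ ⟨_, ⟨g, hg, rfl⟩, rfl⟩
    simp only [stdGenerators, Set.mem_insert_iff, Set.mem_singleton_iff] at hg
    rcases hg with rfl | rfl | rfl | rfl | rfl | rfl | rfl | rfl | rfl | rfl
    · exact a
    · simpa only [SetLike.mem_coe, Subgroup.subtype_apply, genA_one] using second a
    · exact b
    · simpa only [SetLike.mem_coe, Subgroup.subtype_apply, genB_one] using second b
    · exact c
    · simpa only [SetLike.mem_coe, Subgroup.subtype_apply, genC_one] using second c
    · exact d
    · simpa only [SetLike.mem_coe, Subgroup.subtype_apply, genPi_one] using second d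
    · exact e
    · simpa only [SetLike.mem_coe, Subgroup.subtype_apply, genPiBar_one] using second e
  exact this ⟨f, hf, rfl⟩

theorem copy_singleton_mem (b : Bool) {f : Equiv.Perm Square}
    (hf : f ∈ Subgroup.closure stdPerms) : copy [b] f ∈ Subgroup.closure stdPerms := by
  cases b
  · have h := mem_closure_stdPerms (g := genPiBar 0) (by simp [stdGenerators])
    rw [copy_conj isExchange_genPiBar_zero.left]
    exact Subgroup.mul_mem _ (Subgroup.mul_mem _ (Subgroup.inv_mem _ h) (copy_true_mem hf)) h
  · exact copy_true_mem hf

/-! ## Lengths of copies and exchanges -/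

/-- Copying is a homomorphism, so it multiplies lengths by a bounded factor. Iterating this digit by
digit would cost a factor exponential in the depth; deeper strips are instead conjugated to a half
first. -/
theorem exists_hasWord_copy_singleton :
    ∃ K, ∀ b k f, HasWord stdPerms k f → HasWord stdPerms (k * K) (copy [b] f) := by
  have key b := HasWord.exists_map (copy [b]) (S' := stdPerms) finite_stdPerms fun _ hs =>
    copy_singleton_mem b (Subgroup.subset_closure hs)
  choose κ hκ using key
  refine ⟨κ false + κ true, fun b k f h => (hκ b k f h).mono (Nat.mul_le_mul_left _ ?_)⟩
  cases b <;> simp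

theorem exists_mem_map_cone_pair (a b : Bool) :
    ∃ g ∈ Subgroup.closure stdPerms, ∀ p, g (cone [a, b] p) = cone [false] p := by
  have hA := mem_closure_stdPerms (g := genA 0) (by simp [stdGenerators])
  have hπ := mem_closure_stdPerms (g := genPi 0) (by simp [stdGenerators])
  have hπ' := mem_closure_stdPerms (g := genPiBar 0) (by simp [stdGenerators])
  cases a <;> cases b
  · exact ⟨_, hA, genA_zero_left⟩
  · refine ⟨_, Subgroup.mul_mem _ hπ hA, fun p => ?_⟩
    rw [Equiv.Perm.mul_apply, genA_zero_middle, isExchange_genPi_zero.right]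
  · exact ⟨_, hπ, isExchange_genPi_zero.right⟩
  · refine ⟨_, Subgroup.mul_mem _ hπ' (Subgroup.inv_mem _ hA), fun p => ?_⟩
    rw [Equiv.Perm.mul_apply, ← genA_zero_right, perm_inv_apply_self,
      isExchange_genPiBar_zero.right]

/-- Each bounded word replaces the two leading digits of `u` by the single digit `false`, shortening
the address by one. -/
theorem exists_hasWord_map_cone :
    ∃ K, ∀ u ≠ [], ∃ g, HasWord stdPerms (u.length * K) g ∧
      ∀ p, g (cone u p) = cone [false] p := by
  choose s hs hs' using exists_mem_map_cone_pair
  choose κ hκ using fun a b => HasWord.exists_of_mem_closure (hs a b)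
  obtain ⟨k, hk⟩ := HasWord.exists_of_mem_closure
    (mem_closure_stdPerms (g := genPiBar 0) (by simp [stdGenerators]))
  set K := k + ∑ a, ∑ b, κ a b
  have hκK a b : κ a b ≤ K := (Finset.single_le_sum (f := κ a) (fun _ _ => Nat.zero_le _)
    (Finset.mem_univ b)).trans ((Finset.single_le_sum (f := fun a => ∑ b, κ a b)
      (fun _ _ => Nat.zero_le _) (Finset.mem_univ a)).trans (Nat.le_add_left _ _))
  refine ⟨K, fun u => ?_⟩
  induction hn : u.length generalizing u with
  | zero => intro h; exact absurd (List.length_eq_zero_iff.1 hn) h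
  | succ n ih =>
    intro _
    match u, hn with
    | [false], _ => exact ⟨1, .one, fun p => rfl⟩
    | [true], hn =>
      obtain rfl : n = 0 := by simpa using hn
      exact ⟨_, hk.mono (by omega), isExchange_genPiBar_zero.right⟩
    | a :: b :: w, hn =>
      obtain ⟨g, hg, hg'⟩ := ih (false :: w) (by simpa using hn) (by simp)
      refine ⟨g * s a b, (hg.mul ((hκ a b).mono (hκK a b))).mono (by rw [Nat.succ_mul]),
        fun p => ?_⟩
      rw [Equiv.Perm.mul_apply, show a :: b :: w = [a, b] ++ w from rfl, cone_append, hs',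
        ← cone_append]
      exact hg' p

/-- Copying a map of bounded length in a strip costs at most linearly many generators in the depth
of the strip. -/
theorem exists_hasWord_copy :
    ∃ K, ∀ u k f, HasWord stdPerms k f →
      HasWord stdPerms (K * (u.length + k)) (copy u f) := by
  obtain ⟨K, hK⟩ := exists_hasWord_map_cone
  obtain ⟨K', hK'⟩ := exists_hasWord_copy_singleton
  refine ⟨2 * K + K' + 1, fun u k f hf => ?_⟩
  rcases eq_or_ne u [] with rfl | hu
  · rw [copy_nil]
    exact hf.mono (by simp only [List.length_nil]; nlinarith)
  -- Conjugation by `g` reduces to a copy in the left half: the factor `K'` is paid only once, and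
  -- `g` is linear in the depth.
  · obtain ⟨g, hg, hg'⟩ := hK u hu
    rw [copy_conj hg']
    exact ((hg.inv.mul (hK' _ _ _ hf)).mul hg).mono (by nlinarith)

theorem exists_exchange_cons (u v : List Bool) (hu : u = [] ∨ u = [false])
    (hv : v = [] ∨ v = [false]) :
    ∃ t ∈ Subgroup.closure stdPerms, IsExchange (false :: u) (true :: v) t := by
  have hA := mem_closure_stdPerms (g := genA 0) (by simp [stdGenerators])
  have hπ := mem_closure_stdPerms (g := genPi 0) (by simp [stdGenerators])
  have hπ' := mem_closure_stdPerms (g := genPiBar 0) (by simp [stdGenerators])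
  rcases hu with rfl | rfl <;> rcases hv with rfl | rfl
  · exact ⟨_, hπ', isExchange_genPiBar_zero⟩
  · exact ⟨_, hπ, isExchange_genPi_zero⟩
  · refine ⟨_, Subgroup.mul_mem _ (Subgroup.mul_mem _ (Subgroup.inv_mem _ hπ') hπ) hπ',
      isExchange_genPi_zero.symm.conj (fun p => ?_) isExchange_genPiBar_zero.right⟩
    rw [cone_cons, isExchange_genPiBar_zero.left, ← cone_cons]
  -- The map `genPi 0 * genA 0` takes the strips `[false, false]` and `[true, false]` to `[true,
  -- false]` and `[true, true, false]`, which the copy of `genPi 0` in the right half exchanges.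
  · have h : IsExchange [true, false] [true, true, false] (copy [true] (genPi 0).1) :=
      isExchange_genPi_zero.copy [true]
    have hg := Subgroup.mul_mem _ hπ hA
    refine ⟨_, Subgroup.mul_mem _ (Subgroup.mul_mem _ (Subgroup.inv_mem _ hg)
      (copy_singleton_mem true hπ)) hg, h.conj (fun p => ?_) (fun p => ?_)⟩
    · rw [Equiv.Perm.mul_apply, genA_zero_left, isExchange_genPi_zero.left]
    · rw [Equiv.Perm.mul_apply, cone_cons, genA_zero_right, ← cone_append,
        isExchange_genPi_zero.fixed]
      · rfl
      · exact fun q h => cone_singleton_ne (by simp) q _ (h.trans (cone_cons true [true, false] p))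
      · intro q h
        have h' := cone_injective _
          ((cone_cons true [false] q).symm.trans (h.trans (cone_cons true [true, false] p)))
        exact cone_singleton_ne (by simp) q _ (h'.trans (cone_cons true [false] p))

/-- The word `[]` if `u` is empty, and `[false]` otherwise. -/
def stub (u : List Bool) : List Bool := if u = [] then [] else [false]

/-- Since the opposite half stays fixed, strips in the two halves can be normalised independently. A
proper part of a half cannot be moved onto all of that half by such a map, hence the two normal
forms of `stub`. -/
theorem exists_hasWord_map_stub :
    ∃ K, ∀ b u, ∃ g, HasWord stdPerms (u.length * K) g ∧
      (∀ p, g (cone (b :: u) p) = cone (b :: stub u) p) ∧ ∀ p, g (cone [!b] p) = cone [!b] p := by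
  obtain ⟨K, hK⟩ := exists_hasWord_map_cone
  obtain ⟨K', hK'⟩ := exists_hasWord_copy_singleton
  refine ⟨K * K', fun b u => ?_⟩
  rcases eq_or_ne u [] with rfl | hu
  · exact ⟨1, .one, fun _ => rfl, fun _ => rfl⟩
  · obtain ⟨g, hg, hg'⟩ := hK u hu
    refine ⟨copy [b] g, (hK' b _ _ hg).mono (by rw [mul_assoc]), fun p => ?_, fun p => ?_⟩
    · rw [cone_cons, copy_cone, hg', stub, if_neg hu, ← cone_cons]
    · exact copy_of_notMem _ fun q => cone_singleton_ne (by simp) q p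

/-- Normalising both strips leaves four configurations, whose exchanges have bounded length; the
required exchange is a conjugate of one of them. -/
theorem exists_hasWord_exchange_cons :
    ∃ K, ∀ u v, ∃ t, HasWord stdPerms (K * (u.length + v.length + 1)) t ∧
      IsExchange (false :: u) (true :: v) t := by
  obtain ⟨K, hK⟩ := exists_hasWord_map_stub
  have h (u) : stub u = [] ∨ stub u = [false] := by unfold stub; split_ifs <;> simp
  have key : ∃ K, ∀ u v, (u = [] ∨ u = [false]) → (v = [] ∨ v = [false]) →
      ∃ t, HasWord stdPerms K t ∧ IsExchange (false :: u) (true :: v) t := by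
    have (a b : Bool) : ∃ k t, HasWord stdPerms k t ∧ IsExchange
        (false :: if a then [] else [false]) (true :: if b then [] else [false]) t := by
      obtain ⟨t, ht, ht'⟩ := exists_exchange_cons (if a then [] else [false])
        (if b then [] else [false]) (by cases a <;> simp) (by cases b <;> simp)
      obtain ⟨k, hk⟩ := HasWord.exists_of_mem_closure ht
      exact ⟨k, t, hk, ht'⟩
    choose κ t ht ht' using this
    refine ⟨κ true true + κ true false + κ false true + κ false false, ?_⟩
    rintro u v (rfl | rfl) (rfl | rfl)
    · exact ⟨_, (ht true true).mono (by omega), ht' true true⟩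
    · exact ⟨_, (ht true false).mono (by omega), ht' true false⟩
    · exact ⟨_, (ht false true).mono (by omega), ht' false true⟩
    · exact ⟨_, (ht false false).mono (by omega), ht' false false⟩
  obtain ⟨k, hk⟩ := key
  refine ⟨2 * K + k, fun u v => ?_⟩
  obtain ⟨t, ht, ht'⟩ := hk _ _ (h u) (h v)
  obtain ⟨g, hg, hg1, hg2⟩ := hK false u
  obtain ⟨g', hg', hg1', hg2'⟩ := hK true v
  refine ⟨_, (((hg.mul hg').inv.mul ht).mul (hg.mul hg')).mono (by nlinarith),
    ht'.conj (fun p => ?_) fun p => ?_⟩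
  · rw [Equiv.Perm.mul_apply, cone_cons, show g' (cone [false] (cone u p)) = _ from hg2' _,
      Bool.not_true, ← cone_cons, hg1]
  · rw [Equiv.Perm.mul_apply, hg1', cone_cons, show g (cone [true] _) = _ from hg2 _,
      Bool.not_false]

theorem prefix_or_branch (u v : List Bool) :
    u <+: v ∨ v <+: u ∨ ∃ w u' v', (u = w ++ false :: u' ∧ v = w ++ true :: v') ∨
      (u = w ++ true :: u' ∧ v = w ++ false :: v') := by
  induction u generalizing v with
  | nil => exact Or.inl v.nil_prefix
  | cons a u ih =>
    cases v with
    | nil => exact Or.inr (Or.inl List.nil_prefix)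
    | cons b v =>
      rcases eq_or_ne a b with rfl | hab
      · rcases ih v with h | h | ⟨w, u', v', ⟨rfl, rfl⟩ | ⟨rfl, rfl⟩⟩
        · exact Or.inl (by simpa using h)
        · exact Or.inr (Or.inl (by simpa using h))
        · exact Or.inr (Or.inr ⟨a :: w, u', v', Or.inl ⟨rfl, rfl⟩⟩)
        · exact Or.inr (Or.inr ⟨a :: w, u', v', Or.inr ⟨rfl, rfl⟩⟩)
      · refine Or.inr (Or.inr ⟨[], u, v, ?_⟩)
        cases a <;> cases b <;> simp_all

/-- Two disjoint strips can be exchanged by a word of length linear in their depths. -/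
theorem exists_hasWord_exchange :
    ∃ K, ∀ u v, (∀ p q, cone u p ≠ cone v q) →
      ∃ t, HasWord stdPerms (K * (u.length + v.length + 1)) t ∧ IsExchange u v t := by
  obtain ⟨K, hK⟩ := exists_hasWord_exchange_cons
  obtain ⟨K', hK'⟩ := exists_hasWord_copy
  have key (w u v : List Bool) : ∃ t, HasWord stdPerms
      (K' * (1 + K) * ((w ++ false :: u).length + (w ++ true :: v).length + 1)) t ∧
        IsExchange (w ++ false :: u) (w ++ true :: v) t := by
    obtain ⟨t, ht, ht'⟩ := hK u v
    refine ⟨_, (hK' w _ _ ht).mono ?_, ht'.copy w⟩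
    rw [mul_assoc]
    refine Nat.mul_le_mul_left _ ?_
    simp only [List.length_append, List.length_cons]
    nlinarith
  refine ⟨K' * (1 + K), fun u v h => ?_⟩
  -- Comparable addresses would give nested strips. Otherwise the addresses branch after a common
  -- prefix `w`, and the exchange is a copy in the strip `w`.
  rcases prefix_or_branch u v with ⟨w, rfl⟩ | ⟨w, rfl⟩ | ⟨w, u', v', ⟨rfl, rfl⟩ | ⟨rfl, rfl⟩⟩
  · exact absurd (cone_append u w (unitPt, unitPt)).symm (h _ _)
  · exact absurd (cone_append v w (unitPt, unitPt)) (h _ _)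
  · exact key _ _ _
  · obtain ⟨t, ht, ht'⟩ := key w v' u'
    exact ⟨t, ht.mono (by rw [add_comm (List.length _)]), ht'.symm⟩

/-! ## Balanced partitions into vertical strips -/

/-- The address of a node of the infinite binary tree in breadth-first numbering: the root is `1`,
and the children of `m` are `2 * m` and `2 * m + 1`. -/
def addr (m : ℕ) : List Bool := if m ≤ 1 then [] else addr (m / 2) ++ [decide (m % 2 = 1)]

theorem addr_one : addr 1 = [] := by rw [addr]; simp

theorem addr_two_mul {m : ℕ} (hm : 1 ≤ m) : addr (2 * m) = addr m ++ [false] := by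
  rw [addr, if_neg (by omega)]
  congr 2
  · omega
  · simp

theorem addr_two_mul_add_one {m : ℕ} (hm : 1 ≤ m) : addr (2 * m + 1) = addr m ++ [true] := by
  rw [addr, if_neg (by omega)]
  congr 2
  · omega
  · simp

theorem length_addr {m : ℕ} (hm : 1 ≤ m) : (addr m).length = Nat.log 2 m := by
  induction m using Nat.strong_induction_on with
  | _ m ih =>
    rw [addr]
    split_ifs with h
    · obtain rfl : m = 1 := by omega
      simp
    · rw [List.length_append, ih _ (by omega) (by omega), List.length_singleton,
        Nat.log_of_one_lt_of_le one_lt_two (show 2 ≤ m by omega)]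

theorem length_addr_le {m n : ℕ} (hm : 1 ≤ m) (h : m < 2 * n) :
    (addr m).length ≤ Nat.log 2 n + 1 := by
  rw [length_addr hm, ← Nat.log_mul_base one_lt_two (by omega)]
  exact Nat.log_mono_right (by omega)

/-- Induction on `n`: in the step the range of indices loses `n` and gains `2 * n` and `2 * n + 1`,
the two halves of strip `n`. Disjointness, in `cone_addr_ne`, holds for the same reason. -/
theorem exists_cone_addr {n : ℕ} (hn : 1 ≤ n) (p : Square) :
    ∃ i ∈ Finset.Ico n (2 * n), ∃ q, cone (addr i) q = p := by
  induction n, hn using Nat.le_induction with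
  | base => exact ⟨1, by simp, p, by rw [addr_one, cone_nil]⟩
  | succ n hn ih =>
    obtain ⟨i, hi, q, rfl⟩ := ih
    rw [Finset.mem_Ico] at hi
    rcases hi.1.eq_or_lt with rfl | h
    · obtain ⟨b, r, rfl⟩ := exists_cone_singleton q
      cases b
      · exact ⟨2 * n, by rw [Finset.mem_Ico]; omega, r, by rw [addr_two_mul hn, cone_append]⟩
      · exact ⟨2 * n + 1, by rw [Finset.mem_Ico]; omega, r,
          by rw [addr_two_mul_add_one hn, cone_append]⟩
    · exact ⟨i, by rw [Finset.mem_Ico]; omega, q, rfl⟩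

theorem cone_addr_ne {n : ℕ} (hn : 1 ≤ n) {i j : ℕ} (hi : i ∈ Finset.Ico n (2 * n))
    (hj : j ∈ Finset.Ico n (2 * n)) (hij : i ≠ j) (p q : Square) :
    cone (addr i) p ≠ cone (addr j) q := by
  induction n, hn using Nat.le_induction generalizing i j p q with
  | base => simp only [Finset.mem_Ico] at hi hj; omega
  | succ n hn ih =>
    have parent (i : ℕ) (hi : i ∈ Finset.Ico (n + 1) (2 * (n + 1))) :
        (n < i ∧ i ∈ Finset.Ico n (2 * n)) ∨ ∃ b, addr i = addr n ++ [b] ∧ i = 2 * n + b.toNat := by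
      simp only [Finset.mem_Ico] at hi ⊢
      rcases (show i < 2 * n ∨ i = 2 * n ∨ i = 2 * n + 1 by omega) with h | rfl | rfl
      · exact Or.inl (by omega)
      · exact Or.inr ⟨false, addr_two_mul hn, rfl⟩
      · exact Or.inr ⟨true, addr_two_mul_add_one hn, rfl⟩
    have hnn : n ∈ Finset.Ico n (2 * n) := by rw [Finset.mem_Ico]; omega
    rcases parent i hi with ⟨h1, h2⟩ | ⟨b, hb, rfl⟩ <;>
      rcases parent j hj with ⟨h3, h4⟩ | ⟨c, hc, rfl⟩
    · exact ih h2 h4 hij p q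
    · rw [hc, cone_append]
      exact ih h2 hnn h1.ne' _ _
    · rw [hb, cone_append]
      exact ih hnn h4 h3.ne _ _
    · rw [hb, hc, cone_append, cone_append]
      intro h
      exact cone_singleton_ne (by rintro rfl; exact hij rfl) _ _ (cone_injective _ h)

theorem exists_hasWord_exchange_addr :
    ∃ K, ∀ n, 1 ≤ n → ∀ i ∈ Finset.Ico n (2 * n), ∀ j ∈ Finset.Ico n (2 * n), i ≠ j →
      ∃ t, HasWord stdPerms (K * (Nat.log 2 n + 1)) t ∧ IsExchange (addr i) (addr j) t := by
  obtain ⟨K, hK⟩ := exists_hasWord_exchange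
  refine ⟨3 * K, fun n hn i hi j hj hij => ?_⟩
  obtain ⟨t, ht, ht'⟩ := hK _ _ (cone_addr_ne hn hi hj hij)
  rw [Finset.mem_Ico] at hi hj
  have h1 := length_addr_le (hn.trans hi.1) hi.2
  have h2 := length_addr_le (hn.trans hj.1) hj.2
  refine ⟨t, ht.mono ?_, ht'⟩
  rw [mul_comm 3, mul_assoc]
  exact Nat.mul_le_mul_left _ (by omega)

theorem IsExchange.apply_cone_addr {n i j m : ℕ} {t : Equiv.Perm Square}
    (h : IsExchange (addr i) (addr j) t) (hn : 1 ≤ n) (hi : i ∈ Finset.Ico n (2 * n))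
    (hj : j ∈ Finset.Ico n (2 * n)) (hm : m ∈ Finset.Ico n (2 * n)) (p : Square) :
    t (cone (addr m) p) = cone (addr (Equiv.swap i j m)) p := by
  rcases eq_or_ne m i with rfl | h1
  · rw [Equiv.swap_apply_left, h.left]
  · rcases eq_or_ne m j with rfl | h2
    · rw [Equiv.swap_apply_right, h.right]
    · rw [Equiv.swap_apply_of_ne_of_ne h1 h2, h.fixed]
      · exact fun q => cone_addr_ne hn hi hm h1.symm q p
      · exact fun q => cone_addr_ne hn hj hm h2.symm q p

/-! ## Maps permuting a balanced partition -/

theorem exists_hasWord_of_permutes_addr :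
    ∃ K, ∀ n, 1 ≤ n → ∀ f : Equiv.Perm Square,
      (∀ i ∈ Finset.Ico n (2 * n), ∃ j ∈ Finset.Ico n (2 * n),
        ∀ p, f (cone (addr i) p) = cone (addr j) p) →
      HasWord stdPerms (n * (K * (Nat.log 2 n + 1))) f := by
  obtain ⟨K, hK⟩ := exists_hasWord_exchange_addr
  refine ⟨K, fun n hn f hf => ?_⟩
  -- Sorting by exchanges from the top: the strips from `n + k` on are already in place, so at most
  -- `k` exchanges remain.
  suffices key : ∀ k, k ≤ n → ∀ f : Equiv.Perm Square,
      (∀ i ∈ Finset.Ico n (2 * n), ∃ j ∈ Finset.Ico n (2 * n),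
        ∀ p, f (cone (addr i) p) = cone (addr j) p) →
      (∀ i ∈ Finset.Ico (n + k) (2 * n), ∀ p, f (cone (addr i) p) = cone (addr i) p) →
      HasWord stdPerms (k * (K * (Nat.log 2 n + 1))) f from
    key n le_rfl f hf fun i hi => by rw [Finset.mem_Ico] at hi; omega
  clear hf f
  intro k
  induction k with
  | zero =>
    intro _ f _ hf
    have : f = 1 := by
      ext1 p
      obtain ⟨i, hi, q, rfl⟩ := exists_cone_addr hn p
      exact hf i hi q
    rw [this]
    exact .one
  | succ k ih =>
    intro hk f hf hf'
    have hkn : n + k ∈ Finset.Ico n (2 * n) := by rw [Finset.mem_Ico]; omega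
    obtain ⟨j, hj, h⟩ := hf _ hkn
    -- By injectivity, strip `n + k` cannot be sent onto a strip that is already in place.
    have hjk : j ≤ n + k := by
      by_contra! hlt
      have := hf' j (by rw [Finset.mem_Ico] at hj ⊢; omega) (unitPt, unitPt)
      rw [← h, f.injective.eq_iff] at this
      exact cone_addr_ne hn hj hkn hlt.ne' _ _ ((h _).symm.trans this)
    rcases hjk.eq_or_lt with rfl | hlt
    · refine (ih (by omega) f hf fun i hi => ?_).mono (Nat.mul_le_mul_right _ k.le_succ)
      rw [Finset.mem_Ico] at hi
      rcases hi.1.eq_or_lt with rfl | h'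
      · exact h
      · exact hf' i (by rw [Finset.mem_Ico]; omega)
    · obtain ⟨t, ht, ht'⟩ := hK n hn j hj _ hkn hlt.ne
      have h1 : HasWord stdPerms (k * (K * (Nat.log 2 n + 1))) (t * f) := by
        refine ih (by omega) _ (fun i hi => ?_) fun i hi p => ?_
        · obtain ⟨m, hm, h''⟩ := hf i hi
          refine ⟨Equiv.swap j (n + k) m, ?_, fun p => ?_⟩
          · rw [Equiv.swap_apply_def]
            split_ifs <;> assumption
          · rw [Equiv.Perm.mul_apply, h'', ht'.apply_cone_addr hn hj hkn hm]
        · rw [Finset.mem_Ico] at hi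
          rw [Equiv.Perm.mul_apply]
          rcases hi.1.eq_or_lt with rfl | h'
          · rw [h, ht'.left]
          · rw [hf' i (by rw [Finset.mem_Ico]; omega), ht'.apply_cone_addr hn hj hkn
              (by rw [Finset.mem_Ico]; omega), Equiv.swap_apply_of_ne_of_ne (by omega) (by omega)]
      have := ht.inv.mul h1
      rw [inv_mul_cancel_left] at this
      exact this.mono (by rw [Nat.succ_mul, add_comm])

/-! ## Maps from a balanced partition to the partition of a tree -/

/-- `Reaches n k Φ`: a word of length at most `k` maps the balanced partition with `n` pieces
affinely to the partition given by the charts in `Φ`. -/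
def Reaches (n k : ℕ) (Φ : Multiset (Square → Square)) : Prop :=
  ∃ h : Equiv.Perm Square, HasWord stdPerms k h ∧
    ∑ i ∈ Finset.Ico n (2 * n), {⇑h ∘ cone (addr i)} = Φ

/-- The multiset of charts does not record which strip carries which chart. Precomposing with an
exchange therefore puts any chosen chart on strip `n`, the one that is halved in passing to `n + 1`.
-/
theorem Reaches.exists_first :
    ∃ K, ∀ n, 1 ≤ n → ∀ k φ Φ, Reaches n k (φ ::ₘ Φ) →
      ∃ h : Equiv.Perm Square, HasWord stdPerms (k + K * (Nat.log 2 n + 1)) h ∧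
        ⇑h ∘ cone (addr n) = φ ∧ ∑ i ∈ Finset.Ico (n + 1) (2 * n), {⇑h ∘ cone (addr i)} = Φ := by
  obtain ⟨K, hK⟩ := exists_hasWord_exchange_addr
  refine ⟨K, fun n hn k φ Φ => ?_⟩
  rintro ⟨h, hh, hsum⟩
  have hnn : n ∈ Finset.Ico n (2 * n) := by rw [Finset.mem_Ico]; omega
  suffices hs : ∃ g : Equiv.Perm Square, HasWord stdPerms (k + K * (Nat.log 2 n + 1)) g ∧
      ⇑g ∘ cone (addr n) = φ ∧ ∑ i ∈ Finset.Ico n (2 * n), {⇑g ∘ cone (addr i)} = φ ::ₘ Φ by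
    obtain ⟨g, hg, hg1, hg2⟩ := hs
    refine ⟨g, hg, hg1, ?_⟩
    rw [Finset.sum_eq_sum_Ico_succ_bot (by omega), hg1, Multiset.singleton_add] at hg2
    exact (Multiset.cons_inj_right φ).1 hg2
  have hφ : φ ∈ ∑ i ∈ Finset.Ico n (2 * n), ({⇑h ∘ cone (addr i)} : Multiset (Square → Square)) := by
    rw [hsum]
    simp
  obtain ⟨j, hj, hφ⟩ := Multiset.mem_sum.1 hφ
  rw [Multiset.mem_singleton] at hφ
  rcases eq_or_ne n j with rfl | hne
  · exact ⟨h, hh.mono (Nat.le_add_right _ _), hφ.symm, hsum⟩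
  · obtain ⟨t, ht, ht'⟩ := hK n hn n hnn j hj hne
    refine ⟨h * t, hh.mul ht, ?_, ?_⟩
    · rw [hφ]
      funext p
      exact congrArg h (ht'.left p)
    · rw [← hsum]
      refine Finset.sum_equiv (Equiv.swap n j) (fun i => ?_) fun i hi => ?_
      · have hs : ∀ i ∈ Finset.Ico n (2 * n), Equiv.swap n j i ∈ Finset.Ico n (2 * n) := by
          intro i hi
          rw [Equiv.swap_apply_def]
          split_ifs <;> assumption
        exact ⟨hs i, fun h => by simpa using hs _ h⟩
      · congr 1
        funext p
        exact congrArg h (ht'.apply_cone_addr hn hnn hj hi p)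

theorem sum_Ico_split {M : Type*} [AddCommMonoid M] {n : ℕ} (hn : 1 ≤ n) (f : ℕ → M) :
    ∑ i ∈ Finset.Ico (n + 1) (2 * (n + 1)), f i
      = f (2 * n) + (f (2 * n + 1) + ∑ i ∈ Finset.Ico (n + 1) (2 * n), f i) := by
  rw [show 2 * (n + 1) = 2 * n + 1 + 1 by ring, Finset.sum_Ico_succ_top (by omega),
    Finset.sum_Ico_succ_top (by omega)]
  abel

/-- Once the chart sits on strip `n`, a vertical caret costs nothing more: the next balanced
partition halves that strip by itself. -/
theorem Reaches.exists_vert :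
    ∃ K, ∀ n, 1 ≤ n → ∀ k φ Φ, Reaches n k (φ ::ₘ Φ) →
      Reaches (n + 1) (k + K * (Nat.log 2 n + 1)) (φ ∘ leftMap ::ₘ φ ∘ rightMap ::ₘ Φ) := by
  obtain ⟨K, hK⟩ := Reaches.exists_first
  refine ⟨K, fun n hn k φ Φ hΦ => ?_⟩
  obtain ⟨h, hh, rfl, rfl⟩ := hK n hn k φ Φ hΦ
  refine ⟨h, hh, ?_⟩
  rw [sum_Ico_split hn, Multiset.singleton_add, Multiset.singleton_add, addr_two_mul hn,
    addr_two_mul_add_one hn]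
  congr 1
  · funext p
    exact congrArg h (cone_append _ _ _)
  · congr 1
    funext p
    exact congrArg h (cone_append _ _ _)

/-- The inverse of the baker's map takes the left and right halves to the bottom and top ones, so
its copy in strip `n` converts the automatic vertical cut into a horizontal one. -/
theorem Reaches.exists_horiz :
    ∃ K, ∀ n, 1 ≤ n → ∀ k φ Φ, Reaches n k (φ ::ₘ Φ) →
      Reaches (n + 1) (k + K * (Nat.log 2 n + 1)) (φ ∘ bottomMap ::ₘ φ ∘ topMap ::ₘ Φ) := by
  obtain ⟨K, hK⟩ := Reaches.exists_first
  obtain ⟨K', hK'⟩ := exists_hasWord_copy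
  have hC : HasWord stdPerms 1 (genC 0 : Equiv.Perm Square) :=
    .of_mem ⟨genC 0, by simp [stdGenerators], rfl⟩
  refine ⟨K + K', fun n hn k φ Φ hΦ => ?_⟩
  obtain ⟨h, hh, rfl, rfl⟩ := hK n hn k φ Φ hΦ
  set c := (genC 0 : Equiv.Perm Square)⁻¹ with hc
  have hc1 (p : Square) : c (leftMap p) = bottomMap p := by
    rw [hc, Equiv.Perm.inv_eq_iff_eq, genC_zero_bottom]
  have hc2 (p : Square) : c (rightMap p) = topMap p := by
    rw [hc, Equiv.Perm.inv_eq_iff_eq, genC_zero_top]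
  refine ⟨h * copy (addr n) c, (hh.mul (hK' _ _ _ hC.inv)).mono ?_, ?_⟩
  · rw [length_addr hn]
    exact le_of_eq (by ring)
  · rw [sum_Ico_split hn, Multiset.singleton_add, Multiset.singleton_add, addr_two_mul hn,
      addr_two_mul_add_one hn]
    congr 1
    · funext p
      simp only [Function.comp_apply, Equiv.Perm.mul_apply]
      rw [cone_append, copy_cone, cone_false, hc1]
    · congr 1
      · funext p
        simp only [Function.comp_apply, Equiv.Perm.mul_apply]
        rw [cone_append, copy_cone, cone_true, hc2]
      · refine Finset.sum_congr rfl fun i hi => ?_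
        congr 1
        funext p
        simp only [Function.comp_apply, Equiv.Perm.mul_apply]
        rw [copy_of_notMem]
        rw [Finset.mem_Ico] at hi
        exact fun q => cone_addr_ne hn (by rw [Finset.mem_Ico]; omega)
          (by rw [Finset.mem_Ico]; omega) (by omega) _ _

/-- Each caret costs one vertical or horizontal step. The bound `M` on the sizes of all intermediate
partitions makes the cost of the steps uniform. -/
theorem Reaches.exists_tree :
    ∃ K, ∀ (T : CaretTree) (M n k : ℕ) φ Φ, 1 ≤ n → n + T.carets ≤ M → Reaches n k (φ ::ₘ Φ) →
      Reaches (n + T.carets) (k + T.carets * (K * (Nat.log 2 M + 1)))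
        (∑ i, {φ ∘ T.leafMap i} + Φ) := by
  obtain ⟨K, hK⟩ := Reaches.exists_vert
  obtain ⟨K', hK'⟩ := Reaches.exists_horiz
  refine ⟨K + K', fun T M => ?_⟩
  set L := (K + K') * (Nat.log 2 M + 1) with hL
  have mono {n k m : ℕ} {Φ : Multiset (Square → Square)} (h : Reaches n k Φ) (hk : k ≤ m) :
      Reaches n m Φ := ⟨h.choose, h.choose_spec.1.mono hk, h.choose_spec.2⟩
  have bound {n : ℕ} (hn : n ≤ M) {K'' : ℕ} (h : K'' ≤ K + K') :
      K'' * (Nat.log 2 n + 1) ≤ L :=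
    Nat.mul_le_mul h (Nat.succ_le_succ (Nat.log_mono_right hn))
  induction T with
  | leaf =>
    intro n k φ Φ _ _ h
    rw [sum_leaf, Multiset.singleton_add]
    exact mono h (Nat.le_add_right _ _)
  | vert l r hl hr =>
    intro n k φ Φ hn hM h
    simp only [carets] at hM ⊢
    have h1 := mono (hK n hn k φ Φ h) (Nat.add_le_add_left (bound (by omega) (by omega)) k)
    have h2 := hl _ _ _ _ (by omega) (by omega) h1
    rw [Multiset.add_cons] at h2
    have h3 := hr _ _ _ _ (by omega) (by omega) h2
    rw [sum_vert]
    convert h3 using 1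
    · omega
    · ring
    · rw [← add_assoc]
      congr 1
      rw [add_comm]
      rfl
  | horiz l r hl hr =>
    intro n k φ Φ hn hM h
    simp only [carets] at hM ⊢
    have h1 := mono (hK' n hn k φ Φ h) (Nat.add_le_add_left (bound (by omega) (by omega)) k)
    have h2 := hl _ _ _ _ (by omega) (by omega) h1
    rw [Multiset.add_cons] at h2
    have h3 := hr _ _ _ _ (by omega) (by omega) h2
    rw [sum_horiz]
    convert h3 using 1
    · omega
    · ring
    · rw [← add_assoc]
      congr 1
      rw [add_comm]
      rfl

/-! ## The upper bound -/

/-- The map of a tree-pair diagram is represented by a word of length `O(n log n)`, where `n` is the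
number of leaves. -/
theorem exists_hasWord_toPerm :
    ∃ K, ∀ P : TreePair, HasWord stdPerms
      (K * ((P.carets + 1) * (Nat.log 2 (P.carets + 1) + 1))) P.toPerm := by
  obtain ⟨K, hK⟩ := Reaches.exists_tree
  obtain ⟨K', hK'⟩ := exists_hasWord_of_permutes_addr
  have htree (T : CaretTree) : Reaches (T.carets + 1)
      (T.carets * (K * (Nat.log 2 (T.carets + 1) + 1))) (∑ i, {T.leafMap i}) := by
    have h0 : Reaches 1 0 (id ::ₘ 0) :=
      ⟨1, .one, by rw [show Finset.Ico 1 (2 * 1) = {1} from rfl, Finset.sum_singleton,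
        addr_one]; rfl⟩
    have := hK T (T.carets + 1) 1 0 id 0 le_rfl (by omega) h0
    rw [add_zero, zero_add, add_comm 1] at this
    exact this
  refine ⟨2 * K + K', fun P => ?_⟩
  have hcard : P.target.carets = P.source.carets := by
    have := Fintype.card_congr P.perm
    rw [card_leaf, card_leaf, leafCount_eq, leafCount_eq] at this
    omega
  obtain ⟨g, hg, hg'⟩ := htree P.source
  obtain ⟨h, hh, hh'⟩ := htree P.target
  rw [hcard] at hh hh'
  set n := P.source.carets + 1 with hn
  -- As `g` and `h` carry the balanced strips to the leaves of the source and of the target, this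
  -- conjugated map only permutes the balanced strips.
  have hf : HasWord stdPerms (n * (K' * (Nat.log 2 n + 1))) (h⁻¹ * P.toPerm * g) := by
    refine hK' n (by omega) _ fun i hi => ?_
    have h1 : ⇑g ∘ cone (addr i) ∈ ∑ i, ({P.source.leafMap i} : Multiset (Square → Square)) := by
      rw [← hg', Multiset.mem_sum]
      exact ⟨i, hi, Multiset.mem_singleton_self _⟩
    obtain ⟨l, -, hl⟩ := Multiset.mem_sum.1 h1
    rw [Multiset.mem_singleton] at hl
    have h2 : P.target.leafMap (P.perm l) ∈
        ∑ i, ({P.target.leafMap i} : Multiset (Square → Square)) :=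
      Multiset.mem_sum.2 ⟨_, Finset.mem_univ _, Multiset.mem_singleton_self _⟩
    rw [← hh', Multiset.mem_sum] at h2
    obtain ⟨j, hj, hj'⟩ := h2
    rw [Multiset.mem_singleton] at hj'
    refine ⟨j, hj, fun p => ?_⟩
    rw [Equiv.Perm.mul_apply, Equiv.Perm.mul_apply, Equiv.Perm.inv_eq_iff_eq,
      show g (cone (addr i) p) = _ from congrFun hl p, TreePair.toPerm_leafMap, hj']
    rfl
  have := (hh.mul hf).mul hg.inv
  rw [show h * (h⁻¹ * P.toPerm * g) * g⁻¹ = P.toPerm by group] at this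
  refine this.mono ?_
  have : P.carets + 1 = n := rfl
  rw [this]
  have h3 : P.source.carets ≤ n := by omega
  nlinarith [Nat.mul_le_mul_right (K * (Nat.log 2 n + 1)) h3]

/-! ## Leaf counts of common refinements and of products -/

namespace CaretTree

theorem exists_refines_vert_leafCount_le (T : CaretTree) :
    ∃ l r, Refines T (vert l r) ∧ l.leafCount ≤ T.leafCount ∧ r.leafCount ≤ T.leafCount := by
  induction T with
  | leaf => exact ⟨leaf, leaf, leaf_refines _, le_rfl, le_rfl⟩
  | vert l r _ _ =>
    exact ⟨l, r, .refl _, by simp [leafCount], by simp [leafCount]⟩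
  | horiz b t hb ht =>
    obtain ⟨p, q, h, h1, h2⟩ := hb
    obtain ⟨r, s, h', h3, h4⟩ := ht
    exact ⟨_, _, (h.horiz h').trans (swap_refines' _ _ _ _), Nat.add_le_add h1 h3,
      Nat.add_le_add h2 h4⟩

theorem exists_refines_horiz_leafCount_le (T : CaretTree) :
    ∃ l r, Refines T (horiz l r) ∧ l.leafCount ≤ T.leafCount ∧ r.leafCount ≤ T.leafCount := by
  induction T with
  | leaf => exact ⟨leaf, leaf, leaf_refines _, le_rfl, le_rfl⟩
  | horiz l r _ _ =>
    exact ⟨l, r, .refl _, by simp [leafCount], by simp [leafCount]⟩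
  | vert b t hb ht =>
    obtain ⟨p, q, h, h1, h2⟩ := hb
    obtain ⟨r, s, h', h3, h4⟩ := ht
    exact ⟨_, _, (h.vert h').trans (swap_refines _ _ _ _), Nat.add_le_add h1 h3,
      Nat.add_le_add h2 h4⟩

/-- The first cut of `T` splits each rectangle of `S` into at most one piece on either side, so
induction applies to the two subtrees with the second factor not increased. -/
theorem exists_common_refinement_leafCount_le (T S : CaretTree) :
    ∃ W, Refines T W ∧ Refines S W ∧ W.leafCount ≤ T.leafCount * S.leafCount := by
  induction T generalizing S with
  | leaf => exact ⟨S, leaf_refines S, .refl S, by simp [leafCount]⟩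
  | vert l r hl hr =>
    obtain ⟨a, b, h, h1, h2⟩ := exists_refines_vert_leafCount_le S
    obtain ⟨A, hA, hA', h3⟩ := hl a
    obtain ⟨B, hB, hB', h4⟩ := hr b
    refine ⟨.vert A B, hA.vert hB, h.trans (hA'.vert hB'), ?_⟩
    simp only [leafCount, add_mul]
    exact Nat.add_le_add (h3.trans (Nat.mul_le_mul_left _ h1))
      (h4.trans (Nat.mul_le_mul_left _ h2))
  | horiz l r hl hr =>
    obtain ⟨a, b, h, h1, h2⟩ := exists_refines_horiz_leafCount_le S
    obtain ⟨A, hA, hA', h3⟩ := hl a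
    obtain ⟨B, hB, hB', h4⟩ := hr b
    refine ⟨.horiz A B, hA.horiz hB, h.trans (hA'.horiz hB'), ?_⟩
    simp only [leafCount, add_mul]
    exact Nat.add_le_add (h3.trans (Nat.mul_le_mul_left _ h1))
      (h4.trans (Nat.mul_le_mul_left _ h2))

end CaretTree

namespace TreePair

theorem carets_target (P : TreePair) : P.target.carets = P.carets := by
  have := Fintype.card_congr P.perm
  rw [card_leaf, card_leaf, leafCount_eq, leafCount_eq] at this
  simp only [carets]
  omega

theorem carets_symm (P : TreePair) : P.symm.carets = P.carets := P.carets_target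

theorem exists_mul_carets_le (P Q : TreePair) : ∃ R : TreePair, R.toPerm = P.toPerm * Q.toPerm ∧
    R.carets + 1 ≤ (P.carets + 1) * (Q.carets + 1) := by
  obtain ⟨W, hP, hQ, hW⟩ := exists_common_refinement_leafCount_le P.source Q.target
  obtain ⟨⟨_, A, σ⟩, rfl, h1⟩ := exists_source hP
  obtain ⟨⟨_, B, τ⟩, rfl, h2⟩ := exists_source (P := Q.symm) hQ
  have h3 : Q.toPerm = (⟨B, _, τ.symm⟩ : TreePair).toPerm := by
    rw [symm_toPerm, ← inv_eq_iff_eq_inv, ← symm_toPerm] at h2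
    exact h2.symm
  refine ⟨⟨B, A, τ.symm.trans σ⟩, toPerm_eq_of _ _ fun i p => ?_, ?_⟩
  · rw [Equiv.Perm.mul_apply, h3, ← h1]
    exact (congrArg _ (toPerm_leafMap ⟨B, _, τ.symm⟩ i p)).trans (toPerm_leafMap _ _ _)
  · rw [leafCount_eq, leafCount_eq, leafCount_eq, carets_target] at hW
    have := carets_target ⟨_, B, τ⟩
    simp only [carets] at this hW ⊢
    rw [this]
    exact hW

end TreePair

/-! ## Elementary properties of the caret number -/

theorem exists_carets_eq (x : twoV) : ∃ P : TreePair, P.toTwoV = x ∧ P.carets = caretNumber x := by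
  obtain ⟨P, hP⟩ := x.2
  exact Nat.sInf_mem (s := {n : ℕ | ∃ P : TreePair, P.toTwoV = x ∧ P.carets = n})
    ⟨P.carets, P, Subtype.ext hP, rfl⟩

theorem caretNumber_le {x : twoV} {P : TreePair} (h : P.toTwoV = x) : caretNumber x ≤ P.carets :=
  Nat.sInf_le ⟨P, h, rfl⟩

theorem caretNumber_mul_add_one_le (x y : twoV) :
    caretNumber (x * y) + 1 ≤ (caretNumber x + 1) * (caretNumber y + 1) := by
  obtain ⟨P, rfl, hP⟩ := exists_carets_eq x
  obtain ⟨Q, rfl, hQ⟩ := exists_carets_eq y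
  obtain ⟨R, hR, h⟩ := P.exists_mul_carets_le Q
  rw [← hP, ← hQ]
  have hR' : R.toTwoV = P.toTwoV * Q.toTwoV := Subtype.ext hR
  exact (Nat.succ_le_succ (caretNumber_le hR')).trans h

theorem caretNumber_inv (x : twoV) : caretNumber x⁻¹ = caretNumber x := by
  have key (x : twoV) : caretNumber x⁻¹ ≤ caretNumber x := by
    obtain ⟨P, rfl, hP⟩ := exists_carets_eq x
    rw [← hP, ← P.carets_symm]
    exact caretNumber_le (Subtype.ext P.symm_toPerm)
  exact le_antisymm (key x) (by simpa using key x⁻¹)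

theorem caretNumber_one : caretNumber 1 = 0 :=
  Nat.le_zero.1 (caretNumber_le (P := ⟨.leaf, .leaf, Equiv.refl _⟩)
    (Subtype.ext (TreePair.toPerm_eq_of _ _ fun _ _ => rfl)))

theorem caretNumber_pow_add_one_le (x : twoV) (n : ℕ) :
    caretNumber (x ^ n) + 1 ≤ (caretNumber x + 1) ^ n := by
  induction n with
  | zero => simp [caretNumber_one]
  | succ n ih =>
    rw [pow_succ, pow_succ]
    exact (caretNumber_mul_add_one_le _ _).trans (Nat.mul_le_mul_right _ ih)

theorem HasWord.caretNumber_add_one_le {S : Set twoV} {M : ℕ} (hM : ∀ s ∈ S, caretNumber s ≤ M)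
    {k : ℕ} {x : twoV} (h : HasWord S k x) : caretNumber x + 1 ≤ (M + 1) ^ k := by
  obtain ⟨w, h1, rfl, h3⟩ := h
  refine le_trans ?_ (Nat.pow_le_pow_right M.succ_pos h3)
  clear h3
  induction w with
  | nil => simp [caretNumber_one]
  | cons a w ih =>
    have ha : caretNumber a ≤ M := by
      rcases h1 a List.mem_cons_self with h | h
      · exact hM a h
      · simpa [caretNumber_inv] using hM _ h
    rw [List.prod_cons, List.length_cons, pow_succ, mul_comm]
    refine (caretNumber_mul_add_one_le _ _).trans ?_
    rw [mul_comm]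
    refine (Nat.mul_le_mul (ih fun g hg => h1 g (List.mem_cons_of_mem _ hg))
      (Nat.succ_le_succ ha)).trans (le_of_eq (mul_comm _ _))

/-! ## The powers of the baker's map -/

theorem genC_zero_apply (b : Bool) (s t : UnitIoc) :
    (genC 0 : Equiv.Perm Square) (s, half b t) = (half b s, t) := by
  cases b
  · exact genC_zero_bottom (s, t)
  · exact genC_zero_top (s, t)

/-- The baker's map takes digits off the second coordinate and stacks them in front of the first
one, which reverses their order. -/
theorem genC_zero_pow_apply (u : List Bool) (s t : UnitIoc) :
    ((genC 0 : Equiv.Perm Square) ^ u.length) (s, word u t) = (word u.reverse s, t) := by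
  induction u generalizing s with
  | nil => rfl
  | cons b u ih =>
    rw [List.length_cons, pow_succ, Equiv.Perm.mul_apply, word_cons, genC_zero_apply, ih,
      List.reverse_cons, word_append]
    rfl

/-- If the leaf fixes fewer than `n` digits of the second coordinate, its `n`-th digit is free, and
`C₀ⁿ` makes it the leading digit of the first coordinate of the image. But on a leaf the first
coordinate of the image depends on the first coordinate alone. -/
theorem le_length_yWord_of_toPerm_eq {P : TreePair} {n : ℕ}
    (h : P.toPerm = (genC 0 : Equiv.Perm Square) ^ n) (i : P.source.Leaf) :
    n ≤ (P.source.yWord i).length := by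
  by_contra! hlt
  set v := P.source.yWord i with hv
  set u := P.source.xWord i with hu
  obtain ⟨m, hm⟩ : ∃ m, n = v.length + (m + 1) := ⟨n - v.length - 1, by omega⟩
  have key (b : Bool) : (P.target.leafMap (P.perm i) (unitPt, word (List.replicate m false ++ [b])
      unitPt)).1 = half b (word (List.replicate m false ++ v.reverse ++ u) unitPt) := by
    rw [← P.toPerm_leafMap, h, leafMap_eq, ← hu, ← hv, ← word_append]
    have := genC_zero_pow_apply (v ++ (List.replicate m false ++ [b])) (word u unitPt) unitPt
    rw [show (v ++ (List.replicate m false ++ [b])).length = n by simp; omega] at this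
    rw [this]
    simp [word_append]
  have h0 := key false
  have h1 := key true
  rw [leafMap_eq] at h0 h1
  cases (half_eq_half.1 (h0.symm.trans h1)).1

theorem caretNumber_genC_zero_pow (n : ℕ) : caretNumber (genC 0 ^ n) + 1 = 2 ^ n := by
  apply le_antisymm
  · refine (caretNumber_pow_add_one_le _ _).trans (Nat.pow_le_pow_left ?_ n)
    exact Nat.succ_le_succ (caretNumber_le (x := genC 0) rfl)
  · obtain ⟨P, hP, hP'⟩ := exists_carets_eq (genC 0 ^ n)
    have h : P.toPerm = (genC 0 : Equiv.Perm Square) ^ n := congrArg Subtype.val hP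
    rw [← hP']
    have h1 : (1 : ℝ) ≤ (P.carets + 1) * (1 / 2) ^ n := by
      calc (1 : ℝ) = ∑ i, (1 / 2 : ℝ) ^
            ((P.source.xWord i).length + (P.source.yWord i).length) := P.source.sum_area.symm
        _ ≤ ∑ i : P.source.Leaf, (1 / 2 : ℝ) ^ n := Finset.sum_le_sum fun i _ =>
            -- Every leaf has at least `n` digits in the second coordinate, hence area at most
            -- `2⁻ⁿ`.
            pow_le_pow_of_le_one (by norm_num) (by norm_num)
              ((le_length_yWord_of_toPerm_eq h i).trans (Nat.le_add_left _ _))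
        _ = (P.carets + 1) * (1 / 2) ^ n := by
            rw [Finset.sum_const, Finset.card_univ, card_leaf, leafCount_eq, nsmul_eq_mul]
            simp [TreePair.carets]
    rw [one_div, inv_pow, ← div_eq_mul_inv, one_le_div (by positivity)] at h1
    exact_mod_cast h1

/-! ## Permutations of the leaves of an all-right tree -/

/-- The digits of the leaf numbered `i` of the all-right tree with `n` carets. -/
def allRightWord (n i : ℕ) : List Bool :=
  if i < n then List.replicate i true ++ [false] else List.replicate n true

theorem index_vert_inr (l r : CaretTree) (i : r.Leaf) :
    ((vert l r).index (Sum.inr i) : ℕ) = l.leafCount + r.index i := rfl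

theorem xWord_allRight (n : ℕ) (i : (allRight n).Leaf) :
    (allRight n).xWord i = allRightWord n ((allRight n).index i) := by
  induction n with
  | zero => rfl
  | succ n ih =>
    rcases i with ⟨⟩ | i
    · rfl
    · have h : ((allRight (n + 1)).index (Sum.inr i) : ℕ) = (allRight n).index i + 1 :=
        (index_vert_inr leaf (allRight n) i).trans (Nat.add_comm _ _)
      rw [h]
      refine (congrArg (true :: ·) (ih i)).trans ?_
      simp only [allRightWord, Nat.add_lt_add_iff_right]
      split_ifs <;> rfl

theorem yWord_allRight (n : ℕ) (i : (allRight n).Leaf) : (allRight n).yWord i = [] := by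
  induction n with
  | zero => rfl
  | succ n ih =>
    rcases i with ⟨⟩ | i
    · rfl
    · exact ih i

/-- The leaf numbered `i` of the all-right tree. -/
def allRightLeaf (n : ℕ) : Fin (n + 1) ≃ (allRight n).Leaf :=
  (finCongr (leafCount_allRight n).symm).trans (allRight n).index.symm

theorem leafMap_allRightLeaf (n : ℕ) (i : Fin (n + 1)) (p : Square) :
    (allRight n).leafMap (allRightLeaf n i) p = (word (allRightWord n i) p.1, p.2) := by
  rw [leafMap_eq, xWord_allRight, yWord_allRight]
  simp [allRightLeaf]

theorem eq_of_word_allRightWord_eq {n : ℕ} {i j : Fin (n + 1)} {s t : UnitIoc}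
    (h : word (allRightWord n i) s = word (allRightWord n j) t) : i = j := by
  have := (allRight n).leafMap_bijective.1
    (a₁ := (allRightLeaf n i, (s, unitPt))) (a₂ := (allRightLeaf n j, (t, unitPt)))
    (by simp only [leafMap_allRightLeaf, h])
  exact (allRightLeaf n).injective (Prod.mk.inj this).1

/-- The diagram that permutes the leaves of the all-right tree. -/
def permPair (n : ℕ) (σ : Equiv.Perm (Fin (n + 1))) : TreePair :=
  ⟨allRight n, allRight n, (allRightLeaf n).symm.trans (σ.trans (allRightLeaf n))⟩

theorem permPair_toPerm_apply (n : ℕ) (σ : Equiv.Perm (Fin (n + 1))) (i : Fin (n + 1))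
    (s t : UnitIoc) : (permPair n σ).toPerm (word (allRightWord n i) s, t)
      = (word (allRightWord n (σ i)) s, t) := by
  have := (permPair n σ).toPerm_leafMap (allRightLeaf n i) (s, t)
  have h : (permPair n σ).perm (allRightLeaf n i) = allRightLeaf n (σ i) :=
    congrArg (fun j => allRightLeaf n (σ j)) ((allRightLeaf n).symm_apply_apply i)
  rw [h] at this
  exact (congrArg _ (leafMap_allRightLeaf n i (s, t)).symm).trans
    (this.trans (leafMap_allRightLeaf n (σ i) (s, t)))

theorem permPair_toTwoV_injective (n : ℕ) :
    Function.Injective fun σ => (permPair n σ).toTwoV := by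
  intro σ τ h
  ext1 i
  have h' : (permPair n σ).toPerm = (permPair n τ).toPerm := congrArg Subtype.val h
  have := permPair_toPerm_apply n σ i unitPt unitPt
  rw [h', permPair_toPerm_apply] at this
  exact (eq_of_word_allRightWord_eq (Prod.mk.inj this).1).symm

theorem carets_allRight (n : ℕ) : (allRight n).carets = n := by
  have := leafCount_allRight n
  rw [leafCount_eq] at this
  omega

/-- A dyadic interval that meets two of the intervals of the all-right tree contains the last one
strictly. -/
theorem exists_eq_replicate_of_word_eq {n : ℕ} {i j : Fin (n + 1)} (hij : i < j) {u : List Bool}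
    {s s' t t' : UnitIoc} (h : word u s = word (allRightWord n i) t)
    (h' : word u s' = word (allRightWord n j) t') : ∃ k < n, u = List.replicate k true := by
  have key : ¬ allRightWord n i <+: u := by
    rintro ⟨w, rfl⟩
    rw [word_append] at h'
    exact hij.ne (eq_of_word_allRightWord_eq h')
  have hin : (i : ℕ) < n := by
    have := j.2
    rw [Fin.lt_def] at hij
    omega
  rcases prefix_or_prefix_of_word_eq h with h1 | h1
  · have h2 := h1
    rw [allRightWord, if_pos hin, List.prefix_concat_iff] at h2
    rcases h2 with h2 | h2
    · exact absurd (by rw [h2, allRightWord, if_pos hin]) key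
    · rw [List.prefix_replicate_iff] at h2
      exact ⟨_, h2.1.trans_lt hin, h2.2⟩
  · exact absurd h1 key

/-- With fewer carets some source leaf meets two of the strips, and so strictly contains the last
strip horizontally. Its affine image then has the last strip ending in the digit `true`, whereas `σ`
sends that strip onto the one with address `[false]`. -/
theorem caretNumber_permPair {n : ℕ} (hn : 1 ≤ n) {σ : Equiv.Perm (Fin (n + 1))}
    (hσ : σ (Fin.last n) = 0) : caretNumber (permPair n σ).toTwoV = n := by
  refine le_antisymm ((caretNumber_le rfl).trans (carets_allRight n).le) ?_
  obtain ⟨P, hP, hP'⟩ := exists_carets_eq (permPair n σ).toTwoV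
  have hP : P.toPerm = (permPair n σ).toPerm := congrArg Subtype.val hP
  rw [← hP']
  by_contra! hlt
  have hex (i : Fin (n + 1)) : ∃ l q, P.source.leafMap l q
      = (word (allRightWord n i) unitPt, unitPt) := by
    obtain ⟨⟨l, q⟩, h⟩ := P.source.leafMap_bijective.2 (word (allRightWord n i) unitPt, unitPt)
    exact ⟨l, q, h⟩
  choose l q hq using hex
  -- Pigeonhole: one point is chosen in each of the `n + 1` strips, and there are at most `n` source
  -- leaves.
  obtain ⟨i, j, hij, hl⟩ : ∃ i j, i < j ∧ l i = l j := by
    obtain ⟨i, j, hne, hl⟩ := Fintype.exists_ne_map_eq_of_card_lt l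
      (by rw [card_leaf, leafCount_eq, Fintype.card_fin]; exact Nat.succ_lt_succ hlt)
    rcases hne.lt_or_gt with h | h
    · exact ⟨i, j, h, hl⟩
    · exact ⟨j, i, h, hl.symm⟩
  have hi := hq i
  have hj := hq j
  rw [← hl, leafMap_eq] at hj
  rw [leafMap_eq] at hi
  obtain ⟨k, hk, hu⟩ := exists_eq_replicate_of_word_eq hij (Prod.mk.inj hi).1 (Prod.mk.inj hj).1
  obtain ⟨m, rfl⟩ : ∃ m, n = k + (m + 1) := ⟨n - k - 1, by omega⟩
  have hlast : allRightWord (k + (m + 1)) (Fin.last (k + (m + 1)))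
      = List.replicate k true ++ List.replicate (m + 1) true := by
    simp [allRightWord, List.replicate_add]
  have hzero : allRightWord (k + (m + 1)) (0 : Fin (k + (m + 1) + 1)) = [false] := by
    simp [allRightWord]
  have key (t : UnitIoc) : word (P.target.xWord (P.perm (l i)) ++ List.replicate (m + 1) true) t
      = word [false] t := by
    have h1 := P.toPerm_leafMap (l i) (word (List.replicate (m + 1) true) t, unitPt)
    rw [hP, leafMap_eq, leafMap_eq, hu, ← word_append, ← word_append, ← hlast,
      permPair_toPerm_apply, hσ, hzero] at h1
    exact (Prod.mk.inj h1).1.symm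
  have := eq_of_word_eq key
  rw [List.replicate_succ', ← List.append_assoc] at this
  have := congrArg List.getLast? this
  simp at this

theorem factorial_le_ncard_caretNumber_eq {n : ℕ} (hn : 1 ≤ n)
    (hfin : {x : twoV | caretNumber x = n}.Finite) :
    n.factorial ≤ {x : twoV | caretNumber x = n}.ncard := by
  -- The permutation that `decomposeFin` assigns to `(Fin.last n, τ)` sends `0` to the last leaf;
  -- its inverse satisfies the hypothesis of `caretNumber_permPair`, with `τ` free.
  let f : Equiv.Perm (Fin n) → twoV := fun τ =>
    (permPair n (Equiv.Perm.decomposeFin.symm (Fin.last n, τ))⁻¹).toTwoV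
  have hf : Function.Injective f := fun τ τ' h => by
    have := inv_injective (permPair_toTwoV_injective n h)
    exact (Prod.mk.inj (Equiv.Perm.decomposeFin.symm.injective this)).2
  have hsub : f '' Set.univ ⊆ {x : twoV | caretNumber x = n} := by
    rintro _ ⟨τ, -, rfl⟩
    exact caretNumber_permPair hn
      (by rw [Equiv.Perm.inv_eq_iff_eq, Equiv.Perm.decomposeFin_symm_apply_zero])
  have := Set.ncard_le_ncard hsub hfin
  rwa [Set.ncard_image_of_injective _ hf, Set.ncard_univ, Nat.card_eq_fintype_card,
    Fintype.card_perm, Fintype.card_fin] at this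

/-! ## The upper bound for the word length -/

theorem exists_hasWord_stdGenerators :
    ∃ K, ∀ x : twoV, HasWord stdGenerators
      (K * ((caretNumber x + 1) * (Nat.log 2 (caretNumber x + 1) + 1))) x := by
  obtain ⟨K, hK⟩ := exists_hasWord_toPerm
  refine ⟨K, fun x => ?_⟩
  obtain ⟨P, rfl, hP⟩ := exists_carets_eq x
  obtain ⟨y, hy, hy'⟩ := (hK P).exists_preimage twoV.subtype
  rw [← hP]
  convert hy
  exact Subtype.ext hy'.symm

theorem closure_stdGenerators : Subgroup.closure stdGenerators = ⊤ := by
  obtain ⟨K, hK⟩ := exists_hasWord_stdGenerators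
  exact eq_top_iff.2 fun x _ => (hK x).mem_closure

theorem finite_stdGenerators : stdGenerators.Finite := by
  simp only [stdGenerators]
  exact Set.toFinite _

theorem exists_wordLength_le {S : Set twoV} (hS : Subgroup.closure S = ⊤) :
    ∃ K : ℕ, ∀ x : twoV,
      wordLength S x ≤ K * ((caretNumber x + 1) * (Nat.log 2 (caretNumber x + 1) + 1)) := by
  obtain ⟨K, hK⟩ := exists_hasWord_stdGenerators
  obtain ⟨K', hK'⟩ := exists_wordLength_le_mul finite_stdGenerators closure_stdGenerators hS
  refine ⟨K' * K, fun x => (hK' x).trans ?_⟩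
  rw [mul_comm, mul_assoc]
  exact Nat.mul_le_mul_left _ (hK x).wordLength_le

theorem half_le_log_two : (1 / 2 : ℝ) ≤ Real.log 2 := by
  have := Real.log_two_gt_d9
  linarith

theorem add_one_mul_natLog_le {n : ℕ} (hn : 2 ≤ n) :
    (((n + 1) * (Nat.log 2 (n + 1) + 1) : ℕ) : ℝ) ≤ 12 * (n * Real.log n) := by
  have hn' : (2 : ℝ) ≤ n := by exact_mod_cast hn
  have h2 := half_le_log_two
  have h1 : Real.log 2 ≤ Real.log n := Real.log_le_log (by norm_num) hn'
  have h3 : (Nat.log 2 (n + 1) : ℝ) ≤ 4 * Real.log n := by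
    have h4 := Real.natLog_le_logb (n + 1) 2
    rw [Real.logb] at h4
    push_cast at h4
    refine h4.trans ?_
    rw [div_le_iff₀ (by linarith)]
    have h5 : Real.log (n + 1) ≤ 2 * Real.log n := by
      rw [← Real.log_rpow (by linarith) 2]
      exact Real.log_le_log (by linarith) (by norm_num; nlinarith)
    nlinarith
  push_cast
  -- The factor 6 is 4 from `h3` plus 2, as `1 ≤ 2 * log n` by `log n ≥ log 2 ≥ 1/2`.
  calc ((n : ℝ) + 1) * (Nat.log 2 (n + 1) + 1) ≤ (2 * n) * (6 * Real.log n) :=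
        mul_le_mul (by linarith) (by linarith) (by positivity) (by positivity)
    _ = 12 * (n * Real.log n) := by ring

theorem exists_wordLength_le_mul_log {S : Set twoV} (hS : Subgroup.closure S = ⊤) :
    ∃ C : ℝ, 0 < C ∧ ∀ x : twoV,
      (2 ≤ caretNumber x →
        (wordLength S x : ℝ) ≤ C * ((caretNumber x : ℝ) * Real.log (caretNumber x : ℝ))) ∧
      (caretNumber x ≤ 1 → (wordLength S x : ℝ) ≤ C) := by
  obtain ⟨K, hK⟩ := exists_wordLength_le hS
  refine ⟨12 * K + 1, by positivity, fun x => ?_⟩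
  have hx : (wordLength S x : ℝ) ≤ K * (((caretNumber x + 1) *
      (Nat.log 2 (caretNumber x + 1) + 1) : ℕ) : ℝ) := by exact_mod_cast hK x
  refine ⟨fun h => hx.trans ?_, fun h => hx.trans ?_⟩
  · have h1 := add_one_mul_natLog_le h
    have h2 : 0 ≤ (caretNumber x : ℝ) * Real.log (caretNumber x : ℝ) := by positivity
    nlinarith [mul_le_mul_of_nonneg_left h1 (Nat.cast_nonneg (α := ℝ) K)]
  · have h1 : (caretNumber x + 1) * (Nat.log 2 (caretNumber x + 1) + 1) ≤ 2 * (1 + 1) :=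
      Nat.mul_le_mul (by omega) (Nat.succ_le_succ
        ((Nat.log_mono_right (by omega : caretNumber x + 1 ≤ 2)).trans
          (Nat.lt_succ_iff.1 (Nat.log_lt_of_lt_pow two_ne_zero (by norm_num)))))
    have h2 : (((caretNumber x + 1) * (Nat.log 2 (caretNumber x + 1) + 1) : ℕ) : ℝ) ≤ 4 := by
      exact_mod_cast h1
    nlinarith [mul_le_mul_of_nonneg_left h2 (Nat.cast_nonneg (α := ℝ) K)]

/-! ## The lower bound for the word length -/

theorem exists_log_caretNumber_le {S : Set twoV} (hfin : S.Finite)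
    (hS : Subgroup.closure S = ⊤) :
    ∃ C : ℝ, 0 < C ∧ ∀ x : twoV,
      Real.log (caretNumber x : ℝ) ≤ C * (wordLength S x : ℝ) := by
  obtain ⟨M, hM⟩ := (hfin.image caretNumber).bddAbove
  have hM' : ∀ s ∈ S, caretNumber s ≤ M := fun s hs => hM ⟨s, hs, rfl⟩
  have h0 : 0 ≤ Real.log (M + 1) := Real.log_nonneg (by simp)
  refine ⟨Real.log (M + 1) + 1, by linarith, fun x => ?_⟩
  have hx := (hasWord_wordLength (S := S) (x := x) (by simp [hS])).caretNumber_add_one_le hM'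
  have hw : (0 : ℝ) ≤ wordLength S x := Nat.cast_nonneg _
  rcases Nat.eq_zero_or_pos (caretNumber x) with h | h
  · rw [h, Nat.cast_zero, Real.log_zero]
    positivity
  · have h1 : (caretNumber x : ℝ) ≤ (M + 1) ^ wordLength S x := by
      exact_mod_cast (Nat.le_succ _).trans hx
    have h2 := Real.log_le_log (by exact_mod_cast h) h1
    rw [Real.log_pow] at h2
    linarith

theorem exists_wordLength_genC_zero_pow_le {S : Set twoV} (hS : Subgroup.closure S = ⊤) :
    ∃ C : ℝ, 0 < C ∧ ∀ n : ℕ, 2 ≤ n →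
      (wordLength S (genC 0 ^ n) : ℝ) ≤ C * Real.log (caretNumber (genC 0 ^ n) : ℝ) := by
  set k := wordLength S (genC 0)
  -- From `N ≥ 2 ^ (n - 1)`, `n - 1 ≥ n / 2` and `log 2 ≥ 1 / 2` follows `log N ≥ n / 4`; the
  -- summand 1 only ensures positivity.
  refine ⟨4 * k + 1, by positivity, fun n hn => ?_⟩
  have h1 : (wordLength S (genC 0 ^ n) : ℝ) ≤ n * k := by
    exact_mod_cast ((hasWord_wordLength (S := S) (x := genC 0) (by simp [hS])).pow n).wordLength_le
  have h2 : (2 : ℝ) ^ (n - 1) ≤ caretNumber (genC 0 ^ n) := by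
    have h3 := caretNumber_genC_zero_pow n
    obtain ⟨m, rfl⟩ : ∃ m, n = m + 1 := ⟨n - 1, by omega⟩
    rw [pow_succ 2 m] at h3
    have h4 := Nat.one_le_two_pow (n := m)
    rw [Nat.add_sub_cancel]
    exact_mod_cast (show 2 ^ m ≤ caretNumber (genC 0 ^ (m + 1)) by omega)
  have h3 := Real.log_le_log (by positivity) h2
  rw [Real.log_pow, Nat.cast_sub (by omega), Nat.cast_one] at h3
  have hn' : (2 : ℝ) ≤ n := by exact_mod_cast hn
  have h4 : (n : ℝ) / 4 ≤ Real.log (caretNumber (genC 0 ^ n) : ℝ) := by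
    nlinarith [half_le_log_two]
  have hk : (0 : ℝ) ≤ k := Nat.cast_nonneg _
  nlinarith [mul_le_mul_of_nonneg_left h4 hk]

/-! ## The upper bound is generically attained -/

/-- The constant is chosen so that `q ^ L ≤ n ^ (n / 2)`, while `n! ≥ (n / e) ^ n`. The quotient is
thus at most `exp (n - n log n / 2)`, which is at most `exp (-n)` once `log n ≥ 4`; for smaller `n`
the prefactor `exp (2 e⁴)` compensates. -/
theorem pow_div_factorial_le {q : ℕ} (hq : 0 < q) {n L : ℕ} (hn : 1 ≤ n)
    (hL : (L : ℝ) ≤ 1 / (2 * (Real.log q + 1)) * (n * Real.log n)) :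
    (q : ℝ) ^ L / n.factorial ≤ Real.exp (2 * Real.exp 4) * Real.exp (-1) ^ n := by
  have hq1 : (1 : ℝ) ≤ q := by exact_mod_cast hq
  have hn1 : (1 : ℝ) ≤ n := by exact_mod_cast hn
  have hlq : 0 ≤ Real.log q := Real.log_nonneg hq1
  have hln : 0 ≤ Real.log n := Real.log_nonneg hn1
  have h1 : (q : ℝ) ^ L ≤ Real.exp (n * Real.log n / 2) := by
    rw [← Real.rpow_natCast, Real.rpow_def_of_pos (by linarith), Real.exp_le_exp]
    have h2 : Real.log q * (1 / (2 * (Real.log q + 1))) ≤ 1 / 2 := by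
      rw [mul_one_div, div_le_div_iff₀ (by linarith) (by norm_num)]
      linarith
    calc Real.log q * L ≤ Real.log q * (1 / (2 * (Real.log q + 1)) * (n * Real.log n)) :=
          mul_le_mul_of_nonneg_left hL hlq
      _ = Real.log q * (1 / (2 * (Real.log q + 1))) * (n * Real.log n) := by ring
      _ ≤ 1 / 2 * (n * Real.log n) := mul_le_mul_of_nonneg_right h2 (by positivity)
      _ = n * Real.log n / 2 := by ring
  have h2 : Real.exp (n * Real.log n - n) ≤ n.factorial := by
    have h3 := Real.pow_div_factorial_le_exp n (by linarith) n
    rw [div_le_iff₀ (by positivity)] at h3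
    rw [Real.exp_sub, div_le_iff₀ (Real.exp_pos _), mul_comm (n : ℝ), Real.exp_mul,
      Real.exp_log (by linarith), Real.rpow_natCast, mul_comm]
    exact h3
  calc (q : ℝ) ^ L / n.factorial
      ≤ Real.exp (n * Real.log n / 2) / Real.exp (n * Real.log n - n) := by gcongr
    _ = Real.exp (n - n * Real.log n / 2) := by rw [← Real.exp_sub]; ring_nf
    _ ≤ Real.exp (2 * Real.exp 4 + n * -1) := by
      rw [Real.exp_le_exp]
      rcases le_or_gt (Real.exp 4) n with h | h
      · have h4 : 4 ≤ Real.log n := by rwa [Real.le_log_iff_exp_le (by linarith)]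
        nlinarith [Real.exp_pos 4]
      · nlinarith
    _ = Real.exp (2 * Real.exp 4) * Real.exp (-1) ^ n := by
      rw [Real.exp_add, Real.exp_nat_mul]

theorem exists_generic_lower_bound {S : Set twoV} (hfin : S.Finite)
    (hS : Subgroup.closure S = ⊤) :
    ∃ c K r : ℝ, 0 < c ∧ 0 < K ∧ 0 < r ∧ r < 1 ∧ ∀ n : ℕ,
      1 - K * r ^ n ≤
        ({x : twoV | caretNumber x = n ∧
            c * ((n : ℝ) * Real.log (n : ℝ)) < (wordLength S x : ℝ)}.ncard : ℝ) /
          ({x : twoV | caretNumber x = n}.ncard : ℝ) := by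
  obtain ⟨q, hq, hball⟩ := exists_ncard_wordLength_le hfin hS
  obtain ⟨K, hK⟩ := exists_wordLength_le hS
  have hq1 : (1 : ℝ) ≤ q := by exact_mod_cast hq
  have hlq : 0 ≤ Real.log q := Real.log_nonneg hq1
  set c := 1 / (2 * (Real.log q + 1)) with hc
  have hcpos : 0 < c := by positivity
  refine ⟨c, Real.exp (2 * Real.exp 4), Real.exp (-1), hcpos, Real.exp_pos _,
    Real.exp_pos _, by rw [Real.exp_lt_one_iff]; norm_num, fun n => ?_⟩
  rcases Nat.eq_zero_or_pos n with rfl | hn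
  -- For `n = 0` the left side is not positive, because the prefactor is at least 1.
  · refine le_trans ?_ (div_nonneg (Nat.cast_nonneg _) (Nat.cast_nonneg _))
    rw [pow_zero, mul_one, sub_nonpos]
    exact Real.one_le_exp (by positivity)
  set A := {x : twoV | caretNumber x = n} with hA
  -- By the upper bound, the elements with `n` carets lie in a ball. Finiteness matters because
  -- `ncard` is `0` on infinite sets.
  have hAfin : A.Finite := by
    refine (hball (K * ((n + 1) * (Nat.log 2 (n + 1) + 1)))).1.subset fun x hx => ?_
    have := hK x
    rwa [show caretNumber x = n from hx] at this
  have hfact := factorial_le_ncard_caretNumber_eq hn hAfin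
  set B := {x : twoV | caretNumber x = n ∧
    c * ((n : ℝ) * Real.log (n : ℝ)) < (wordLength S x : ℝ)} with hB
  set L := ⌊c * ((n : ℝ) * Real.log (n : ℝ))⌋₊ with hL
  have hBA : B ⊆ A := fun x hx => hx.1
  have hn1 : (1 : ℝ) ≤ n := by exact_mod_cast hn
  have hnonneg : 0 ≤ c * ((n : ℝ) * Real.log (n : ℝ)) :=
    mul_nonneg hcpos.le (mul_nonneg (by linarith) (Real.log_nonneg hn1))
  -- The exceptional elements have word length at most `c n log n`, so they lie in the ball of
  -- radius `L`.
  have hdiff : (A \ B).ncard ≤ q ^ L := by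
    refine (Set.ncard_le_ncard ?_ (hball L).1).trans (hball L).2
    rintro x ⟨hxA, hxB⟩
    exact Nat.le_floor (not_lt.1 fun h => hxB ⟨hxA, h⟩)
  have hsum : (A.ncard : ℝ) = (A \ B).ncard + B.ncard := by
    exact_mod_cast (Set.ncard_sdiff_add_ncard_of_subset hBA hAfin).symm
  have hfpos : (0 : ℝ) < n.factorial := by positivity
  have hfact' : (n.factorial : ℝ) ≤ A.ncard := by exact_mod_cast hfact
  have hApos : (0 : ℝ) < A.ncard := hfpos.trans_le hfact'
  have hdiff' : ((A \ B).ncard : ℝ) ≤ q ^ L := by exact_mod_cast hdiff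
  have key : ((A \ B).ncard : ℝ) / A.ncard ≤ Real.exp (2 * Real.exp 4) * Real.exp (-1) ^ n :=
    (div_le_div₀ (by positivity) hdiff' hfpos hfact').trans
      (pow_div_factorial_le hq hn (Nat.floor_le hnonneg))
  have : (B.ncard : ℝ) / A.ncard = 1 - (A \ B).ncard / A.ncard := by
    rw [eq_sub_iff_add_eq, ← add_div, add_comm, ← hsum, div_self hApos.ne']
  rw [this]
  linarith

end BrinThompson

open BrinThompson in
theorem theorem3p2 :
    -- the standard set generates, so that its word length is a genuine word length
    Subgroup.closure stdGenerators = ⊤ ∧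
    -- the number of carets of the powers of the baker's map
    (∀ n : ℕ, caretNumber (genC 0 ^ n) + 1 = 2 ^ n) ∧
    -- for the standard generating set, and for every other finite generating set:
    ∀ S : Set twoV, S.Finite → Subgroup.closure S = ⊤ →
      -- the lower bound
      (∃ C : ℝ, 0 < C ∧ ∀ x : twoV,
        Real.log (caretNumber x : ℝ) ≤ C * (wordLength S x : ℝ)) ∧
      -- the upper bound
      (∃ C : ℝ, 0 < C ∧ ∀ x : twoV,
        (2 ≤ caretNumber x →
          (wordLength S x : ℝ) ≤ C * ((caretNumber x : ℝ) * Real.log (caretNumber x : ℝ))) ∧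
        (caretNumber x ≤ 1 → (wordLength S x : ℝ) ≤ C)) ∧
      -- the lower bound is attained by the powers of the baker's map
      (∃ C : ℝ, 0 < C ∧ ∀ n : ℕ, 2 ≤ n →
        (wordLength S (genC 0 ^ n) : ℝ) ≤ C * Real.log (caretNumber (genC 0 ^ n) : ℝ)) ∧
      -- the upper bound is attained, by all but an exponentially small fraction of the elements
      (∃ c K r : ℝ, 0 < c ∧ 0 < K ∧ 0 < r ∧ r < 1 ∧ ∀ n : ℕ,
        1 - K * r ^ n ≤
          ({x : twoV | caretNumber x = n ∧
              c * ((n : ℝ) * Real.log (n : ℝ)) < (wordLength S x : ℝ)}.ncard : ℝ) /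
            ({x : twoV | caretNumber x = n}.ncard : ℝ)) := by
  refine ⟨closure_stdGenerators, caretNumber_genC_zero_pow, fun S hfin hS => ?_⟩
  exact ⟨exists_log_caretNumber_le hfin hS, exists_wordLength_le_mul_log hS,
    exists_wordLength_genC_zero_pow_le hS, exists_generic_lower_bound hfin hS⟩
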